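/- Let $\mathbb K$ be a field of characteristic zero, let $d\ge 2$ be an even integer, and let $A=\mathbb K[x^1,\dots,x^d]$. Let $C^{\ge 1}(A)=\bigoplus_{k\ge 1}\mathrm{Hom}_{\mathbb K}(A^{\otimes k},A)$ be the truncated Hochschild cochain complex, in which a cochain with $k=n+1$ arguments has degree $n$, equipped with the Gerstenhaber bracket $$[Q_1,Q_2]_G=Q_1\circ Q_2-(-1)^{k_1k_2}\,Q_2\circ Q_1,\qquad (Q_1\circ Q_2)(a_0,\dots,a_{k_1+k_2})=\sum_{i=0}^{k_1}(-1)^{ik_2}Q_1(a_0,\dots,Q_2(a_i,\dots,a_{i+k_2}),\dots,a_{k_1+k_2})$$ for $Q_i$ with $k_i+1$ arguments, and with the Hochschild differential, normalized as $P\mapsto[m,P]_G=(-1)^n\,\partial^{Hoch}P$ for $P$ of degree $n$, where $m$ is the multiplication of $A$ and $$(\partial^{Hoch}P)(a_0,\dots,a_k)=a_0P(a_1,\dots,a_k)+\sum_{i=0}^{k-1}(-1)^{i+1}P(a_0,\dots,a_ia_{i+1},\dots,a_k)+(-1)^{k+1}P(a_0,\dots,a_{k-1})a_k .$$ Then the DG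 Lie algebra $C^{\ge 1}(A)$ is not formal. That is, there is no finite zigzag of quasi-isomorphisms of ($\mathbb Z$-graded) DG Lie algebras over $\mathbb K$ $$C^{\ge1}(A)\xrightarrow{\ \sim\ }\bullet\xleftarrow{\ \sim\ }\bullet\xrightarrow{\ \sim\ }\cdots\xleftarrow{\ \sim\ }H^\bullet(C^{\ge1}(A))$$ connecting it to its cohomology, where the cohomology is regarded as a DG Lie algebra with the induced bracket and zero differential, and a quasi-isomorphism is a morphism of DG Lie algebras inducing isomorphisms on cohomology. -/

import Mathlib

universe u v

/-- A differential graded Lie algebra over `K`: a `ℤ`-graded vector space with a differential of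
degree `1` and a graded skew-symmetric bracket of degree `0` satisfying the graded Jacobi identity
and the graded Leibniz rule. (Degrees of outputs are pinned by equations, to avoid transports.) -/
structure DGLieAlgebra (K : Type u) [Field K] where
  X : ℤ → Type v
  [addCommGroup : ∀ n, AddCommGroup (X n)]
  [module : ∀ n, Module K (X n)]
  d : ∀ {p q : ℤ}, p + 1 = q → X p →ₗ[K] X q
  bracket : ∀ {p q r : ℤ}, p + q = r → X p →ₗ[K] X q →ₗ[K] X r
  d_d : ∀ {p q r : ℤ} (hq : p + 1 = q) (hr : q + 1 = r) (a : X p), d hr (d hq a) = 0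
  skew : ∀ {p q r : ℤ} (h : p + q = r) (h' : q + p = r) (a : X p) (b : X q),
    bracket h a b = -((p * q).negOnePow • bracket h' b a)
  jacobi : ∀ {p q r pq qr rp s : ℤ} (hpq : p + q = pq) (hqr : q + r = qr) (hrp : r + p = rp)
    (h1 : pq + r = s) (h2 : qr + p = s) (h3 : rp + q = s) (a : X p) (b : X q) (c : X r),
    (p * r).negOnePow • bracket h1 (bracket hpq a b) c
      + (q * p).negOnePow • bracket h2 (bracket hqr b c) a
      + (r * q).negOnePow • bracket h3 (bracket hrp c a) b = 0
  leibniz : ∀ {p p' q q' r r' : ℤ} (hp : p + 1 = p') (hq : q + 1 = q') (hr : r + 1 = r')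
    (h : p + q = r) (h1 : p' + q = r') (h2 : p + q' = r') (a : X p) (b : X q),
    d hr (bracket h a b) = bracket h1 (d hp a) b + p.negOnePow • bracket h2 a (d hq b)

namespace DGLieAlgebra

attribute [instance] DGLieAlgebra.addCommGroup DGLieAlgebra.module

variable {K : Type u} [Field K]

/-- Morphisms of DG Lie algebras. -/
structure Hom (L M : DGLieAlgebra.{u, v} K) where
  toFun : ∀ n : ℤ, L.X n →ₗ[K] M.X n
  map_d : ∀ {p q : ℤ} (h : p + 1 = q) (a : L.X p), toFun q (L.d h a) = M.d h (toFun p a)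
  map_bracket : ∀ {p q r : ℤ} (h : p + q = r) (a : L.X p) (b : L.X q),
    toFun r (L.bracket h a b) = M.bracket h (toFun p a) (toFun q b)

/-- Cocycles of degree `n`. -/
def cocycles (L : DGLieAlgebra.{u, v} K) (n : ℤ) : Submodule K (L.X n) :=
  LinearMap.ker (L.d (rfl : n + 1 = n + 1))

/-- Coboundaries of degree `n`, as a subspace of the cocycles. -/
def coboundaries (L : DGLieAlgebra.{u, v} K) (n : ℤ) : Submodule K (L.cocycles n) :=
  (LinearMap.range (L.d (sub_add_cancel n 1))).comap (L.cocycles n).subtype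

/-- The cohomology space of degree `n`. -/
abbrev H (L : DGLieAlgebra.{u, v} K) (n : ℤ) : Type v := L.cocycles n ⧸ L.coboundaries n

theorem d_eq_zero (L : DGLieAlgebra.{u, v} K) {p q : ℤ} (h : p + 1 = q) (a : L.cocycles p) :
    L.d h (a : L.X p) = 0 := by
  subst h
  exact a.2

theorem mem_coboundaries (L : DGLieAlgebra.{u, v} K) {p q : ℤ} (h : p + 1 = q)
    (z : L.cocycles q) (a : L.X p) (e : L.d h a = (z : L.X q)) : z ∈ L.coboundaries q := by
  obtain rfl : p = q - 1 := by omega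
  exact ⟨a, e⟩

theorem exists_of_mem_coboundaries (L : DGLieAlgebra.{u, v} K) {p q : ℤ} (h : p + 1 = q)
    (z : L.cocycles q) (hz : z ∈ L.coboundaries q) : ∃ a : L.X p, L.d h a = (z : L.X q) := by
  obtain rfl : p = q - 1 := by omega
  exact hz

/-- The bracket of two cocycles is a cocycle. -/
def cocycleBracket (L : DGLieAlgebra.{u, v} K) {p q r : ℤ} (h : p + q = r) :
    L.cocycles p →ₗ[K] L.cocycles q →ₗ[K] L.cocycles r :=
  LinearMap.mk₂ K
    (fun a b => ⟨L.bracket h (a : L.X p) (b : L.X q), by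
      change L.d rfl _ = 0
      rw [L.leibniz (p' := p + 1) (q' := q + 1) rfl rfl rfl h (by omega) (by omega),
        L.d_eq_zero rfl a, L.d_eq_zero rfl b]
      simp⟩)
    (fun _ _ _ => Subtype.ext (by simp)) (fun _ _ _ => Subtype.ext (by simp))
    (fun _ _ _ => Subtype.ext (by simp)) (fun _ _ _ => Subtype.ext (by simp))

/-- The bracket induced on cohomology. -/
def cohomologyBracket (L : DGLieAlgebra.{u, v} K) {p q r : ℤ} (h : p + q = r) :
    L.H p →ₗ[K] L.H q →ₗ[K] L.H r :=
  (L.coboundaries p).liftQ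
    (LinearMap.flip ((L.coboundaries q).liftQ
      (LinearMap.flip ((L.cocycleBracket h).compr₂ (L.coboundaries r).mkQ)) (by
        intro b hb
        obtain ⟨c, hc⟩ := L.exists_of_mem_coboundaries (sub_add_cancel q 1) b hb
        refine LinearMap.ext fun a => ?_
        refine (Submodule.Quotient.mk_eq_zero _).2 ?_
        refine L.mem_coboundaries (p := r - 1) (by omega) _
          (p.negOnePow • L.bracket (by omega : p + (q - 1) = r - 1) (a : L.X p) c) ?_
        have e := L.leibniz (p := p) (q := q - 1) (r := r - 1) rfl (sub_add_cancel q 1)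
          (sub_add_cancel r 1) (by omega) (by omega) h (a : L.X p) c
        rw [L.d_eq_zero rfl a, hc] at e
        simp only [map_zero, LinearMap.zero_apply, zero_add] at e
        rw [Units.smul_def, map_zsmul, e, ← Units.smul_def, smul_smul, ← Int.negOnePow_add,
          Int.negOnePow_even _ ⟨p, rfl⟩, one_smul]
        rfl))) (by
    intro a ha
    obtain ⟨c, hc⟩ := L.exists_of_mem_coboundaries (sub_add_cancel p 1) a ha
    refine LinearMap.ext fun b => ?_
    induction b using Submodule.Quotient.induction_on with
    | _ b =>
    refine (Submodule.Quotient.mk_eq_zero _).2 ?_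
    refine L.mem_coboundaries (p := r - 1) (by omega) _
      (L.bracket (by omega : (p - 1) + q = r - 1) c (b : L.X q)) ?_
    rw [L.leibniz (sub_add_cancel p 1) (q' := q + 1) rfl (sub_add_cancel r 1) (by omega) h
      (by omega), L.d_eq_zero rfl b, hc]
    simp
    rfl)

theorem cohomologyBracket_mk (L : DGLieAlgebra.{u, v} K) {p q r : ℤ} (h : p + q = r)
    (a : L.cocycles p) (b : L.cocycles q) :
    L.cohomologyBracket h (Submodule.Quotient.mk a) (Submodule.Quotient.mk b)
      = Submodule.Quotient.mk (L.cocycleBracket h a b) := rfl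

theorem mk_units_smul (L : DGLieAlgebra.{u, v} K) {n : ℤ} (e : ℤˣ) (a : L.cocycles n) :
    e • (Submodule.Quotient.mk a : L.H n) = Submodule.Quotient.mk (e • a) := by
  rw [Units.smul_def, Units.smul_def]
  exact (map_zsmul (L.coboundaries n).mkQ _ a).symm

/-- The cohomology of a DG Lie algebra, with the induced bracket and zero differential. -/
def cohomology (L : DGLieAlgebra.{u, v} K) : DGLieAlgebra.{u, v} K where
  X := L.H
  d _ := 0
  bracket h := L.cohomologyBracket h
  d_d _ _ _ := rfl
  skew {p q r} h h' a b := by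
    induction a using Submodule.Quotient.induction_on with
    | _ a =>
    induction b using Submodule.Quotient.induction_on with
    | _ b =>
    rw [cohomologyBracket_mk, cohomologyBracket_mk, mk_units_smul, ← Submodule.Quotient.mk_neg]
    congr 1
    exact Subtype.ext (L.skew h h' a b)
  jacobi {p q r pq qr rp s} hpq hqr hrp h1 h2 h3 a b c := by
    induction a using Submodule.Quotient.induction_on with
    | _ a =>
    induction b using Submodule.Quotient.induction_on with
    | _ b =>
    induction c using Submodule.Quotient.induction_on with
    | _ c =>
    simp only [cohomologyBracket_mk, mk_units_smul, ← Submodule.Quotient.mk_add]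
    rw [← Submodule.Quotient.mk_zero]
    congr 1
    exact Subtype.ext (L.jacobi hpq hqr hrp h1 h2 h3 a b c)
  leibniz _ _ _ _ _ _ _ _ := by simp

/-- The map induced on cohomology by a morphism. -/
def Hom.cohomologyMap {L M : DGLieAlgebra.{u, v} K} (f : Hom L M) (n : ℤ) :
    L.H n →ₗ[K] M.H n :=
  (L.coboundaries n).mapQ (M.coboundaries n)
    ((f.toFun n).restrict (p := L.cocycles n) (q := M.cocycles n) (fun a ha => by
      change M.d rfl _ = 0
      rw [← f.map_d, show L.d rfl a = 0 from ha, map_zero]))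
    (fun z hz => by
      obtain ⟨a, ha⟩ := hz
      exact ⟨f.toFun _ a, by rw [← f.map_d, ha]; rfl⟩)

/-- A quasi-isomorphism is a morphism inducing isomorphisms on all cohomology spaces. -/
def Hom.IsQuasiIso {L M : DGLieAlgebra.{u, v} K} (f : Hom L M) : Prop :=
  ∀ n : ℤ, Function.Bijective (f.cohomologyMap n)

/-- Two DG Lie algebras are quasi-isomorphic if a finite zigzag of quasi-isomorphisms
connects them. -/
def QuasiIsomorphic (L M : DGLieAlgebra.{u, v} K) : Prop :=
  Relation.EqvGen (fun L' M' : DGLieAlgebra.{u, v} K => ∃ f : Hom L' M', f.IsQuasiIso) L M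

/-- A DG Lie algebra is formal if it is quasi-isomorphic to its cohomology. -/
def IsFormal (L : DGLieAlgebra.{u, v} K) : Prop :=
  QuasiIsomorphic L L.cohomology

end DGLieAlgebra

namespace Hochschild

variable (K : Type u) [Field K] (A : Type v) [Ring A] [Algebra K A]

/-- Hochschild cochains of degree `n` in the shifted grading: multilinear maps `A^(n+1) → A`. -/
abbrev Cochain (n : ℕ) : Type v := MultilinearMap K (fun _ : Fin (n + 1) => A) A

variable {K A}

/-- The arguments fed to the outer cochain when a cochain `g` of degree `q` is inserted into
slot `i`: `a_0, …, a_{i-1}, g(a_i, …, a_{i+q}), a_{i+q+1}, …, a_{p+q}`. -/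
def insertArgs {p q r : ℕ} (h : p + q = r) (i : Fin (p + 1)) (g : Cochain K A q)
    (a : Fin (r + 1) → A) (j : Fin (p + 1)) : A :=
  if j < i then a ⟨j, by omega⟩
  else if j = i then g (fun l : Fin (q + 1) => a ⟨i + l, by omega⟩)
  else a ⟨j + q, by omega⟩

theorem insertArgs_update {p q r : ℕ} (h : p + q = r) (i : Fin (p + 1)) (g : Cochain K A q)
    (t : Fin (r + 1)) : ∃ (j : Fin (p + 1)) (φ : (Fin (r + 1) → A) → A →ₗ[K] A),
      (∀ a x, φ (Function.update a t x) = φ a) ∧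
      ∀ a x, insertArgs h i g (Function.update a t x)
        = Function.update (insertArgs h i g a) j (φ a x) := by
  classical
  by_cases h1 : (t : ℕ) < i
  · refine ⟨⟨t, by omega⟩, fun _ => LinearMap.id, fun _ _ => rfl, fun a x => ?_⟩
    funext j
    simp only [insertArgs, Function.update_apply, Fin.ext_iff, Fin.lt_def, LinearMap.id_apply]
    have : (fun l : Fin (q + 1) => if (i : ℕ) + l = t then x else a ⟨i + l, by omega⟩)
        = fun l : Fin (q + 1) => a ⟨i + l, by omega⟩ := by
      funext l; rw [if_neg (by omega)]
    rw [this]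
    split_ifs <;> first | rfl | omega
  · by_cases h2 : (t : ℕ) ≤ i + q
    · refine ⟨i, fun a => g.toLinearMap (fun l : Fin (q + 1) => a ⟨i + l, by omega⟩)
        ⟨t - i, by omega⟩, fun a x => ?_, fun a x => ?_⟩
      · refine LinearMap.ext fun y => ?_
        simp only [MultilinearMap.toLinearMap_apply]
        congr 1
        funext l
        simp only [Function.update_apply, Fin.ext_iff]
        split_ifs <;> first | rfl | omega
      · funext j
        simp only [insertArgs, Function.update_apply, Fin.ext_iff, Fin.lt_def,
          MultilinearMap.toLinearMap_apply]
        have : (fun l : Fin (q + 1) => if (i : ℕ) + l = t then x else a ⟨i + l, by omega⟩)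
            = Function.update (fun l : Fin (q + 1) => a ⟨i + l, by omega⟩)
              ⟨t - i, by omega⟩ x := by
          funext l
          simp only [Function.update_apply, Fin.ext_iff]
          split_ifs <;> first | rfl | omega
        rw [this]
        split_ifs <;> first | rfl | omega
    · refine ⟨⟨t - q, by omega⟩, fun _ => LinearMap.id, fun _ _ => rfl, fun a x => ?_⟩
      funext j
      simp only [insertArgs, Function.update_apply, Fin.ext_iff, Fin.lt_def, LinearMap.id_apply]
      have : (fun l : Fin (q + 1) => if (i : ℕ) + l = t then x else a ⟨i + l, by omega⟩)
          = fun l : Fin (q + 1) => a ⟨i + l, by omega⟩ := by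
        funext l; rw [if_neg (by omega)]
      rw [this]
      split_ifs <;> first | rfl | omega

theorem insertArgs_eq_update {p q r : ℕ} (h : p + q = r) (i : Fin (p + 1)) (g : Cochain K A q)
    (a : Fin (r + 1) → A) : insertArgs h i g a
      = Function.update (insertArgs h i (0 : Cochain K A q) a) i
        (g (fun l : Fin (q + 1) => a ⟨i + l, by omega⟩)) := by
  funext j
  simp only [insertArgs, Function.update_apply, Fin.ext_iff, Fin.lt_def]
  split_ifs <;> first | rfl | omega

/-- Insertion of `g` into slot `i` of `f`:
`f(a_0, …, a_{i-1}, g(a_i, …, a_{i+q}), a_{i+q+1}, …, a_{p+q})`. -/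
def insertAt {p q r : ℕ} (h : p + q = r) (i : Fin (p + 1)) :
    Cochain K A p →ₗ[K] Cochain K A q →ₗ[K] Cochain K A r :=
  LinearMap.mk₂ K
    (fun f g => MultilinearMap.mk' (fun a => f (insertArgs h i g a))
      (fun a t x y => by
        obtain ⟨j, φ, -, e⟩ := insertArgs_update h i g t
        simp only [e, map_add, MultilinearMap.map_update_add])
      (fun a t c x => by
        obtain ⟨j, φ, -, e⟩ := insertArgs_update h i g t
        simp only [e, map_smul, MultilinearMap.map_update_smul]))
    (fun _ _ _ => MultilinearMap.ext fun _ => rfl)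
    (fun _ _ _ => MultilinearMap.ext fun _ => rfl)
    (fun f g g' => MultilinearMap.ext fun a => by
      change f (insertArgs h i (g + g') a) = f (insertArgs h i g a) + f (insertArgs h i g' a)
      rw [insertArgs_eq_update h i (g + g'), insertArgs_eq_update h i g,
        insertArgs_eq_update h i g', add_apply, MultilinearMap.map_update_add])
    (fun c f g => MultilinearMap.ext fun a => by
      change f (insertArgs h i (c • g) a) = c • f (insertArgs h i g a)
      rw [insertArgs_eq_update h i (c • g), insertArgs_eq_update h i g,
        smul_apply, MultilinearMap.map_update_smul])

theorem insertAt_apply {p q r : ℕ} (h : p + q = r) (i : Fin (p + 1)) (f : Cochain K A p)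
    (g : Cochain K A q) (a : Fin (r + 1) → A) :
    insertAt h i f g a = f (insertArgs h i g a) := rfl

/-- `f ∘ g = ∑_{i=0}^{p} (-1)^{iq} f(a_0, …, g(a_i, …, a_{i+q}), …, a_{p+q})`. -/
def circ {p q r : ℕ} (h : p + q = r) :
    Cochain K A p →ₗ[K] Cochain K A q →ₗ[K] Cochain K A r :=
  ∑ i : Fin (p + 1), (-1 : ℤ) ^ ((i : ℕ) * q) • insertAt h i

theorem circ_apply {p q r : ℕ} (h : p + q = r) (f : Cochain K A p) (g : Cochain K A q) :
    circ h f g = ∑ i : Fin (p + 1), (-1 : ℤ) ^ ((i : ℕ) * q) • insertAt h i f g := by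
  simp [circ, LinearMap.sum_apply]

/-- The Gerstenhaber bracket `[f, g] = f ∘ g - (-1)^{pq} g ∘ f`. -/
def gerstenhaber {p q r : ℕ} (h : p + q = r) :
    Cochain K A p →ₗ[K] Cochain K A q →ₗ[K] Cochain K A r :=
  LinearMap.mk₂ K
    (fun f g => circ h f g - (-1 : ℤ) ^ (p * q) • circ (by omega : q + p = r) g f)
    (fun f f' g => by simp only [map_add, LinearMap.add_apply, smul_add]; abel)
    (fun c f g => by
      simp only [map_smul, LinearMap.smul_apply, smul_sub, smul_comm c ((-1 : ℤ) ^ (p * q))])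
    (fun f g g' => by simp only [map_add, LinearMap.add_apply, smul_add]; abel)
    (fun c f g => by
      simp only [map_smul, LinearMap.smul_apply, smul_sub, smul_comm c ((-1 : ℤ) ^ (p * q))])

variable (K A) in
/-- The multiplication of `A`, a cochain of degree `1`. -/
def mulCochain : Cochain K A 1 := MultilinearMap.mkPiAlgebraFin K 2 A

/-- The Hochschild differential of `P` with `k = n + 1` arguments:
`(∂P)(a_0, …, a_k) = a_0 P(a_1, …, a_k) - P(a_0 a_1, …, a_k) + … + (-1)^k P(a_0, …, a_{k-1} a_k)
+ (-1)^{k+1} P(a_0, …, a_{k-1}) a_k`. -/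
def differential {n k : ℕ} (h : n + 1 = k) : Cochain K A n →ₗ[K] Cochain K A k :=
  insertAt (by omega : 1 + n = k) 1 (mulCochain K A)
    + ∑ i : Fin (n + 1), (-1 : ℤ) ^ ((i : ℕ) + 1) • (insertAt h i).flip (mulCochain K A)
    + (-1 : ℤ) ^ (k + 1) • insertAt (by omega : 1 + n = k) 0 (mulCochain K A)

/-- The formula for the Hochschild differential, in terms of elements. -/
theorem differential_apply {n k : ℕ} (h : n + 1 = k) (P : Cochain K A n)
    (a : Fin (k + 1) → A) :
    differential h P a
      = a 0 * P (fun j => a ⟨j + 1, by omega⟩)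
        + ∑ i : Fin (n + 1), (-1 : ℤ) ^ ((i : ℕ) + 1) • P (fun j =>
            if j < i then a ⟨j, by omega⟩
            else if j = i then a ⟨i, by omega⟩ * a ⟨i + 1, by omega⟩
            else a ⟨j + 1, by omega⟩)
        + (-1 : ℤ) ^ (k + 1) • (P (fun j => a ⟨j, by omega⟩) * a (Fin.last k)) := by
  have e1 : ∀ b : Fin 2 → A, mulCochain K A b = b 0 * b 1 := fun b => by
    simp [mulCochain, MultilinearMap.mkPiAlgebraFin_apply, List.ofFn_succ]
  subst h
  have e2 : ∀ i : Fin (n + 1), insertArgs (rfl : n + 1 = n + 1) i (mulCochain K A) a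
      = fun j => if j < i then a ⟨j, by omega⟩
            else if j = i then a ⟨i, by omega⟩ * a ⟨i + 1, by omega⟩
            else a ⟨j + 1, by omega⟩ := by
    intro i
    funext j
    simp [insertArgs, e1]
  simp only [differential, LinearMap.add_apply, LinearMap.sum_apply, LinearMap.smul_apply,
    add_apply, sum_apply, smul_apply,
    LinearMap.flip_apply, insertAt_apply, e1, e2]
  congr 1
  · congr 1
    simp [insertArgs, add_comm]
  · simp [insertArgs, Fin.last, add_comm]

section Sequences

/-- Evaluation of a cochain on the first entries of a sequence. -/
def seqEval {n : ℕ} (f : Cochain K A n) (s : ℕ → A) : A := f (fun j => s j)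

theorem seqEval_injective {n : ℕ} {f g : Cochain K A n} (h : ∀ s, seqEval f s = seqEval g s) :
    f = g := by
  refine MultilinearMap.ext fun a => ?_
  have := h (fun j => if hj : j < n + 1 then a ⟨j, hj⟩ else 0)
  simpa only [seqEval, Fin.is_lt, dite_true, Fin.eta] using this

/-- Insertion of arguments at the level of sequences. -/
def seqInsert {B : Type v} (i q : ℕ) (G : (ℕ → B) → B) (s : ℕ → B) (j : ℕ) : B :=
  if j < i then s j else if j = i then G (fun l => s (i + l)) else s (j + q)

theorem seqEval_insertAt {p q r : ℕ} (h : p + q = r) (i : Fin (p + 1)) (f : Cochain K A p)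
    (g : Cochain K A q) (s : ℕ → A) :
    seqEval (insertAt h i f g) s = seqEval f (seqInsert i q (seqEval g) s) := by
  simp only [seqEval, insertAt_apply]
  congr 1
  funext j
  simp only [insertArgs, seqInsert, Fin.lt_def, Fin.ext_iff, seqEval]

theorem seqEval_circ {p q r : ℕ} (h : p + q = r) (f : Cochain K A p)
    (g : Cochain K A q) (s : ℕ → A) :
    seqEval (circ h f g) s = ∑ i ∈ Finset.range (p + 1),
      (-1 : ℤ) ^ (i * q) • seqEval f (seqInsert i q (seqEval g) s) := by
  rw [← Fin.sum_univ_eq_sum_range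
    (fun i => (-1 : ℤ) ^ (i * q) • seqEval f (seqInsert i q (seqEval g) s))]
  simp only [← seqEval_insertAt h]
  simp [circ, seqEval, LinearMap.sum_apply]

theorem seqEval_congr {n : ℕ} (f : Cochain K A n) {s t : ℕ → A} (h : ∀ j ≤ n, s j = t j) :
    seqEval f s = seqEval f t := by
  simp only [seqEval]
  congr 1
  funext j
  exact h j (by omega)

theorem seqEval_sum {ι : Type*} {p : ℕ} (f : Cochain K A p) (i k : ℕ) (hi : i ≤ p)
    (S : Finset ι) (c : ι → ℤ) (G : ι → (ℕ → A) → A) (s : ℕ → A) :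
    seqEval f (seqInsert i k (fun t => ∑ l ∈ S, c l • G l t) s)
      = ∑ l ∈ S, c l • seqEval f (seqInsert i k (G l) s) := by
  have key : ∀ G : (ℕ → A) → A, seqEval f (seqInsert i k G s)
      = f.toLinearMap (fun j => seqInsert i k (fun _ => 0) s j) ⟨i, by omega⟩
        (G (fun l => s (i + l))) := by
    intro G
    simp only [seqEval, MultilinearMap.toLinearMap_apply]
    congr 1
    funext j
    simp only [seqInsert, Function.update_apply, Fin.ext_iff]
    split_ifs <;> first | rfl | omega
  simp only [key, map_sum, map_zsmul]

theorem seqInsert_nested {B : Type v} (i j q r : ℕ) (G H : (ℕ → B) → B) (s : ℕ → B)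
    (h2 : j ≤ q) :
    seqInsert i q G (seqInsert (i + j) r H s)
      = seqInsert i (q + r) (fun t => G (seqInsert j r H t)) s := by
  funext n
  unfold seqInsert
  split_ifs with a1 a2 a3 a4 a5 a6 <;> try omega
  · rfl
  · congr 1
    funext l
    split_ifs <;> first | omega | rfl | skip
    · simp only [add_assoc]
    · simp only [add_assoc]
  · congr 1; omega

theorem seqInsert_disjoint {r : ℕ} (i j q : ℕ) (G : (ℕ → A) → A) (f : Cochain K A r)
    (s : ℕ → A) (hij : j < i) :
    seqInsert i q G (seqInsert j r (seqEval f) s)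
      = seqInsert j r (seqEval f) (seqInsert (i + r) q G s) := by
  funext n
  rcases lt_trichotomy n j with h | h | h
  · simp [seqInsert, h, h.trans hij, show n < i + r by omega]
  · subst h
    simp only [seqInsert, hij, lt_irrefl, if_true, if_false]
    exact seqEval_congr f fun l hl => by simp [show n + l < i + r by omega]
  · rcases lt_trichotomy n i with h' | h' | h'
    · simp [seqInsert, h', h.not_gt, h.ne']
    · subst h'
      simp only [seqInsert, h.not_gt, h.ne', lt_irrefl, if_true, if_false]
      congr 1
      funext l
      simp [show ¬ n + l < j by omega, show n + l ≠ j by omega]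
      congr 1; omega
    · simp [seqInsert, h'.not_gt, h'.ne', h.not_gt, h.ne', show ¬ n + q < j by omega,
        show n + q ≠ j by omega]
      congr 1; omega

/-- The graded pre-Lie identity. -/
theorem circ_preLie {p q r pq qr s : ℕ} (hpq : p + q = pq) (hqr : q + r = qr) {pr : ℕ}
    (hpr : p + r = pr) (hrq : r + q = qr) (h1 : pq + r = s) (h2 : p + qr = s) (h3 : pr + q = s)
    (f : Cochain K A p) (g : Cochain K A q) (h : Cochain K A r) :
    circ h1 (circ hpq f g) h - circ h2 f (circ hqr g h)
      = (-1 : ℤ) ^ (q * r) • (circ h3 (circ hpr f h) g - circ h2 f (circ hrq h g)) := by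
  have main : ∀ {q r pq qr : ℕ} (hpq : p + q = pq) (hqr : q + r = qr) (h1 : pq + r = s)
      (h2 : p + qr = s) (g : Cochain K A q) (h : Cochain K A r) (t : ℕ → A),
      seqEval (circ h1 (circ hpq f g) h - circ h2 f (circ hqr g h)) t
        = (∑ i ∈ Finset.range (p + 1), ∑ j ∈ Finset.range i, (-1 : ℤ) ^ (j * r + i * q) •
            seqEval f (seqInsert i q (seqEval g) (seqInsert j r (seqEval h) t)))
          + (-1 : ℤ) ^ (q * r) •
          (∑ i ∈ Finset.range (p + 1), ∑ j ∈ Finset.range i, (-1 : ℤ) ^ (j * q + i * r) •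
            seqEval f (seqInsert i r (seqEval h) (seqInsert j q (seqEval g) t))) := by
    intro q r pq qr hpq hqr h1 h2 g h t
    subst hpq hqr
    have e1 : seqEval (circ h1 (circ rfl f g) h) t
        = ∑ i ∈ Finset.range (p + 1), ∑ j ∈ Finset.range (p + q + 1),
          (-1 : ℤ) ^ (j * r + i * q) •
            seqEval f (seqInsert i q (seqEval g) (seqInsert j r (seqEval h) t)) := by
      rw [Finset.sum_comm, seqEval_circ]
      refine Finset.sum_congr rfl fun j _ => ?_
      rw [seqEval_circ, Finset.smul_sum]
      refine Finset.sum_congr rfl fun i _ => ?_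
      rw [smul_smul, pow_add]
    have e2 : seqEval (circ h2 f (circ rfl g h)) t
        = ∑ i ∈ Finset.range (p + 1), ∑ j ∈ Finset.range (q + 1),
          (-1 : ℤ) ^ ((i + j) * r + i * q) •
            seqEval f (seqInsert i q (seqEval g) (seqInsert (i + j) r (seqEval h) t)) := by
      rw [seqEval_circ]
      refine Finset.sum_congr rfl fun i hi => ?_
      have : seqEval (circ (rfl : q + r = q + r) g h) = fun t => ∑ l ∈ Finset.range (q + 1),
          (-1 : ℤ) ^ (l * r) • seqEval g (seqInsert l r (seqEval h) t) :=
        funext fun t => seqEval_circ _ _ _ _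
      rw [this, seqEval_sum f i (q + r) (by simp at hi; omega) _ _
        (fun l t => seqEval g (seqInsert l r (seqEval h) t)), Finset.smul_sum]
      refine Finset.sum_congr rfl fun j hj => ?_
      rw [smul_smul, ← pow_add, seqInsert_nested _ _ _ _ _ _ _ (by simp at hj; omega)]
      congr 2
      ring
    have e3 : seqEval (circ h1 (circ rfl f g) h - circ h2 f (circ rfl g h)) t
        = seqEval (circ h1 (circ rfl f g) h) t - seqEval (circ h2 f (circ rfl g h)) t := rfl
    rw [e3, e1, e2, ← Finset.sum_sub_distrib, Finset.smul_sum]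
    have e4 : ∀ i ∈ Finset.range (p + 1), (∑ j ∈ Finset.range (p + q + 1),
          (-1 : ℤ) ^ (j * r + i * q) •
            seqEval f (seqInsert i q (seqEval g) (seqInsert j r (seqEval h) t)))
          - (∑ j ∈ Finset.range (q + 1), (-1 : ℤ) ^ ((i + j) * r + i * q) •
            seqEval f (seqInsert i q (seqEval g) (seqInsert (i + j) r (seqEval h) t)))
        = (∑ j ∈ Finset.range i, (-1 : ℤ) ^ (j * r + i * q) •
            seqEval f (seqInsert i q (seqEval g) (seqInsert j r (seqEval h) t)))
          + ∑ j ∈ Finset.Ico (i + 1) (p + 1), (-1 : ℤ) ^ (q * r) • (-1 : ℤ) ^ (i * q + j * r) •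
            seqEval f (seqInsert j r (seqEval h) (seqInsert i q (seqEval g) t)) := by
      intro i hi
      simp only [Finset.mem_range] at hi
      rw [show p + q + 1 = i + (q + 1) + (p - i) by omega, Finset.sum_range_add,
        Finset.sum_range_add, Finset.sum_Ico_eq_sum_range,
        show p + 1 - (i + 1) = p - i by omega]
      have : ∀ l, (-1 : ℤ) ^ ((i + (q + 1) + l) * r + i * q) •
            seqEval f (seqInsert i q (seqEval g) (seqInsert (i + (q + 1) + l) r (seqEval h) t))
          = (-1 : ℤ) ^ (q * r) • (-1 : ℤ) ^ (i * q + (i + 1 + l) * r) •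
            seqEval f (seqInsert (i + 1 + l) r (seqEval h) (seqInsert i q (seqEval g) t)) := by
        intro l
        rw [smul_smul, ← pow_add, seqInsert_disjoint (i + 1 + l) i r (seqEval h) g t (by omega),
          show i + (q + 1) + l = i + 1 + l + q by omega]
        congr 2
        ring
      simp only [this]
      abel
    rw [Finset.sum_congr rfl e4, Finset.sum_add_distrib]
    congr 1
    simp only [Finset.smul_sum]
    exact Finset.sum_comm' (by intro x y; simp; omega)
  refine seqEval_injective fun t => ?_
  have e : ∀ (n : ℤ) (u : Cochain K A s), seqEval (n • u) t = n • seqEval u t := fun _ _ => rfl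
  rw [main, e, main, smul_add, smul_smul, mul_comm r q, ← pow_add, ← two_mul,
    Even.neg_one_pow (even_two_mul (q * r)), one_smul, add_comm]

end Sequences

theorem gerstenhaber_apply {p q r : ℕ} (h : p + q = r) (h' : q + p = r) (f : Cochain K A p)
    (g : Cochain K A q) :
    gerstenhaber h f g = circ h f g - (-1 : ℤ) ^ (p * q) • circ h' g f := rfl

theorem neg_one_pow_cases (n : ℕ) : (-1 : ℤ) ^ n = 1 ∨ (-1 : ℤ) ^ n = -1 :=
  neg_one_pow_eq_or ℤ n

theorem gerstenhaber_skew {p q r : ℕ} (h : p + q = r) (h' : q + p = r) (f : Cochain K A p)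
    (g : Cochain K A q) :
    gerstenhaber h f g = -((-1 : ℤ) ^ (p * q) • gerstenhaber h' g f) := by
  rw [gerstenhaber_apply h h', gerstenhaber_apply h' h, mul_comm q p]
  rcases neg_one_pow_cases (p * q) with e | e <;> rw [e] <;> simp

theorem gerstenhaber_jacobi {p q r pq qr rp s : ℕ} (hpq : p + q = pq) (hqr : q + r = qr)
    (hrp : r + p = rp) (h1 : pq + r = s) (h2 : qr + p = s) (h3 : rp + q = s)
    (f : Cochain K A p) (g : Cochain K A q) (h : Cochain K A r) :
    (-1 : ℤ) ^ (p * r) • gerstenhaber h1 (gerstenhaber hpq f g) h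
      + (-1 : ℤ) ^ (q * p) • gerstenhaber h2 (gerstenhaber hqr g h) f
      + (-1 : ℤ) ^ (r * q) • gerstenhaber h3 (gerstenhaber hrp h f) g = 0 := by
  have hqp : q + p = pq := by omega
  have hrq : r + q = qr := by omega
  have hpr : p + r = rp := by omega
  have h1' : r + pq = s := by omega
  have h2' : p + qr = s := by omega
  have h3' : q + rp = s := by omega
  have A1 := circ_preLie hpq hqr hpr hrq h1 h2' h3 f g h
  have A2 := circ_preLie hqr hrp hqp hpr h2 h3' h1 g h f
  have A3 := circ_preLie hrp hpq hrq hqp h3 h1' h2 h f g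
  simp only [gerstenhaber_apply h1 h1', gerstenhaber_apply h2 h2', gerstenhaber_apply h3 h3',
    gerstenhaber_apply hpq hqp, gerstenhaber_apply hqr hrq, gerstenhaber_apply hrp hpr,
    map_sub, LinearMap.sub_apply, map_zsmul, LinearMap.smul_apply]
  have x1 : (-1 : ℤ) ^ (pq * r) = (-1) ^ (p * r) * (-1) ^ (q * r) := by
    rw [← hpq, add_mul, pow_add]
  have x2 : (-1 : ℤ) ^ (qr * p) = (-1) ^ (p * q) * (-1) ^ (p * r) := by
    rw [← hqr, add_mul, pow_add, mul_comm q p, mul_comm r p]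
  have x3 : (-1 : ℤ) ^ (rp * q) = (-1) ^ (q * r) * (-1) ^ (p * q) := by
    rw [← hrp, add_mul, pow_add, mul_comm q r]
  rw [mul_comm r p] at A2 ⊢
  rw [x1, x2, x3, mul_comm q p, mul_comm r q]
  clear x1 x2 x3
  replace A1 := congrArg (fun u => (-1 : ℤ) ^ (p * r) • u) A1
  replace A2 := congrArg (fun u => (-1 : ℤ) ^ (p * q) • u) A2
  replace A3 := congrArg (fun u => (-1 : ℤ) ^ (q * r) • u) A3
  rcases neg_one_pow_cases (p * q) with e1 | e1 <;>
  rcases neg_one_pow_cases (p * r) with e2 | e2 <;>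
  rcases neg_one_pow_cases (q * r) with e3 | e3 <;>
  simp only [e1, e2, e3, one_smul, neg_smul, mul_one, mul_neg, neg_neg] at A1 A2 A3 ⊢ <;>
  linear_combination (norm := module) A1 + A2 + A3

theorem gerstenhaber_mulCochain {n k : ℕ} (h : n + 1 = k) (h' : 1 + n = k) (P : Cochain K A n) :
    gerstenhaber h' (mulCochain K A) P = (-1 : ℤ) ^ n • differential h P := by
  have e0 : ∀ φ : Fin (1 + 1) → Cochain K A k, ∑ i, φ i = φ 0 + φ 1 := Fin.sum_univ_two
  have e1 : differential h P = insertAt h' 1 (mulCochain K A) P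
      + ∑ i : Fin (n + 1), (-1 : ℤ) ^ ((i : ℕ) + 1) • insertAt h i P (mulCochain K A)
      + (-1 : ℤ) ^ (k + 1) • insertAt h' 0 (mulCochain K A) P := by
    simp [differential, LinearMap.sum_apply]
  have e2 : (-1 : ℤ) ^ (k + 1) = (-1) ^ n := by
    rw [← h, pow_add, pow_add]; simp
  rw [gerstenhaber_apply h' h, circ_apply, circ_apply, e0, e1, e2]
  simp only [mul_one, one_mul, pow_succ, mul_neg, neg_smul, Finset.sum_neg_distrib]
  simp only [Fin.val_zero, Fin.val_one, zero_mul, one_mul, pow_zero, one_smul]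
  rcases neg_one_pow_cases n with e | e <;> rw [e] <;> module

theorem gerstenhaber_mul_mul :
    gerstenhaber (rfl : 1 + 1 = 2) (mulCochain K A) (mulCochain K A) = 0 := by
  have e1 : ∀ s : ℕ → A, seqEval (mulCochain K A) s = s 0 * s 1 := fun s => by
    simp [seqEval, mulCochain, MultilinearMap.mkPiAlgebraFin_apply, List.ofFn_succ]
  have e2 : circ (rfl : 1 + 1 = 2) (mulCochain K A) (mulCochain K A) = 0 := by
    refine seqEval_injective fun s => ?_
    rw [seqEval_circ]
    simp [Finset.sum_range_succ, e1, seqInsert, mul_assoc]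
    simp [seqEval]
  rw [gerstenhaber_apply rfl rfl, e2]
  simp

theorem gerstenhaber_mul_leibniz {p p' q q' r r' : ℕ} (hp : 1 + p = p') (hq : 1 + q = q')
    (hr : 1 + r = r') (h : p + q = r) (h1 : p' + q = r') (h2 : p + q' = r')
    (f : Cochain K A p) (g : Cochain K A q) :
    gerstenhaber hr (mulCochain K A) (gerstenhaber h f g)
      = gerstenhaber h1 (gerstenhaber hp (mulCochain K A) f) g
        + (-1 : ℤ) ^ p • gerstenhaber h2 f (gerstenhaber hq (mulCochain K A) g) := by
  have hq' : q + 1 = q' := by omega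
  have hr' : r + 1 = r' := by omega
  have h2' : q' + p = r' := by omega
  have J := gerstenhaber_jacobi hp h hq' h1 hr' h2' (mulCochain K A) f g
  rw [gerstenhaber_skew hr' hr, gerstenhaber_skew hq' hq] at J
  simp only [map_neg, LinearMap.neg_apply, map_zsmul, LinearMap.smul_apply] at J
  rw [gerstenhaber_skew h2' h2] at J
  subst hq h
  simp only [mul_one, one_mul, add_mul, pow_add, mul_comm q p] at J
  rcases neg_one_pow_cases p with e1 | e1 <;> rcases neg_one_pow_cases q with e2 | e2 <;>
  rcases neg_one_pow_cases (p * q) with e3 | e3 <;>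
  simp only [e1, e2, e3, one_smul, neg_smul, mul_one, mul_neg, neg_neg, smul_neg] at J ⊢ <;>
  first
  | linear_combination (norm := module) J
  | linear_combination (norm := module) -J

theorem gerstenhaber_mul_sq [CharZero K] {p q r : ℕ} (hq : 1 + p = q) (hr : 1 + q = r)
    (f : Cochain K A p) :
    gerstenhaber hr (mulCochain K A) (gerstenhaber hq (mulCochain K A) f) = 0 := by
  have h2 : 2 + p = r := by omega
  have L := gerstenhaber_mul_leibniz (rfl : 1 + 1 = 2) hq hr hq h2 hr (mulCochain K A) f
  rw [gerstenhaber_mul_mul] at L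
  simp only [map_zero, LinearMap.zero_apply, zero_add, pow_one, neg_smul, one_smul] at L
  have h3 : (2 : K) • gerstenhaber hr (mulCochain K A) (gerstenhaber hq (mulCochain K A) f)
      = 0 := by
    linear_combination (norm := module) L
  exact (smul_eq_zero.1 h3).resolve_left two_ne_zero

variable (K A) in
/-- The graded vector space `C^{≥ 1}(A)` with shifted grading: multilinear maps with `n + 1`
arguments in degree `n ≥ 0`, and zero in negative degrees. -/
def Truncated : ℤ → Type v
  | .ofNat n => Cochain K A n
  | .negSucc _ => PUnit.{v + 1}

instance : ∀ n : ℤ, AddCommGroup (Truncated K A n)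
  | .ofNat n => inferInstanceAs (AddCommGroup (Cochain K A n))
  | .negSucc _ => inferInstanceAs (AddCommGroup PUnit.{v + 1})

instance : ∀ n : ℤ, Module K (Truncated K A n)
  | .ofNat n => inferInstanceAs (Module K (Cochain K A n))
  | .negSucc _ => inferInstanceAs (Module K PUnit.{v + 1})

/-- The differential `P ↦ (-1)^n ∂P` for `P` of degree `n`. -/
def truncatedD : ∀ {p q : ℤ}, p + 1 = q → Truncated K A p →ₗ[K] Truncated K A q
  | .ofNat p, .ofNat _, h => (-1 : ℤ) ^ p • differential (K := K) (A := A) (Int.ofNat.inj h)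
  | .ofNat _, .negSucc _, _ => 0
  | .negSucc _, _, _ => 0

/-- The Gerstenhaber bracket on `C^{≥ 1}(A)`. -/
def truncatedBracket : ∀ {p q r : ℤ}, p + q = r →
    Truncated K A p →ₗ[K] Truncated K A q →ₗ[K] Truncated K A r
  | .ofNat _, .ofNat _, .ofNat _, h => gerstenhaber (K := K) (A := A) (Int.ofNat.inj h)
  | .ofNat _, .ofNat _, .negSucc _, _ => 0
  | .ofNat _, .negSucc _, _, _ => 0
  | .negSucc _, _, _, _ => 0

theorem truncated_eq_zero {n : ℕ} (a : Truncated K A (.negSucc n)) : a = 0 := rfl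

/-- A cochain with `n + 1` arguments as an element of degree `n`. -/
def toTruncated (n : ℕ) : Cochain K A n →ₗ[K] Truncated K A (Int.ofNat n) := LinearMap.id

theorem toTruncated_surjective {n : ℕ} (a : Truncated K A (Int.ofNat n)) :
    ∃ b, toTruncated n b = a := ⟨a, rfl⟩

theorem truncatedD_ofNat {p q : ℕ} (h : Int.ofNat p + 1 = Int.ofNat q) (h' : 1 + p = q)
    (a : Cochain K A p) :
    truncatedD h (toTruncated p a) = toTruncated q (gerstenhaber h' (mulCochain K A) a) :=
  (gerstenhaber_mulCochain (Int.ofNat.inj h) h' a).symm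

theorem truncatedBracket_ofNat {p q r : ℕ} (h : Int.ofNat p + Int.ofNat q = Int.ofNat r)
    (h' : p + q = r) (a : Cochain K A p) (b : Cochain K A q) :
    truncatedBracket h (toTruncated p a) (toTruncated q b)
      = toTruncated r (gerstenhaber h' a b) := rfl

theorem negOnePow_natCast (n : ℕ) : (((n : ℤ).negOnePow : ℤˣ) : ℤ) = (-1) ^ n := by
  simp [Int.negOnePow_def]

theorem negOnePow_smul_ofNat {n : ℕ} (k : ℤ) (m : ℕ) (e : k = m) (a : Cochain K A n) :
    k.negOnePow • toTruncated n a = toTruncated n ((-1 : ℤ) ^ m • a) := by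
  subst e
  rw [Units.smul_def, negOnePow_natCast, map_zsmul]

variable (K A) in
/-- The DG Lie algebra `C^{≥ 1}(A)` of Hochschild cochains with at least one argument. A cochain
with `n + 1` arguments has degree `n`, the bracket is the Gerstenhaber bracket, and the
differential is the Hochschild differential `∂` with the sign `(-1)^n` in degree `n`, that is, the
bracket with the multiplication of `A` on the left. (The sign is what the graded Leibniz rule, in
the form required above, needs for this bracket.) -/
def truncatedDGLie [CharZero K] : DGLieAlgebra.{u, v} K where
  X := Truncated K A
  d := truncatedD
  bracket := truncatedBracket
  d_d {p q r} hq hr a := by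
    rcases p with p | p
    swap
    · rw [truncated_eq_zero a, map_zero, map_zero]
    obtain ⟨a, rfl⟩ := toTruncated_surjective a
    obtain ⟨q, rfl⟩ : ∃ n : ℕ, q = Int.ofNat n := ⟨q.toNat, by simp at hq ⊢; omega⟩
    obtain ⟨r, rfl⟩ : ∃ n : ℕ, r = Int.ofNat n := ⟨r.toNat, by simp at hr ⊢; omega⟩
    have hq' : 1 + p = q := by simp at hq; omega
    have hr' : 1 + q = r := by simp at hr; omega
    rw [truncatedD_ofNat hq hq', truncatedD_ofNat hr hr', gerstenhaber_mul_sq hq' hr' a, map_zero]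
  skew {p q r} h h' a b := by
    rcases p with p | p
    swap
    · rw [truncated_eq_zero a]; simp
    obtain ⟨a, rfl⟩ := toTruncated_surjective a
    rcases q with q | q
    swap
    · rw [truncated_eq_zero b]; simp
    obtain ⟨b, rfl⟩ := toTruncated_surjective b
    obtain ⟨r, rfl⟩ : ∃ n : ℕ, r = Int.ofNat n := ⟨r.toNat, by simp at h ⊢; omega⟩
    have k : p + q = r := by simp at h; omega
    have k' : q + p = r := by omega
    rw [truncatedBracket_ofNat h k, truncatedBracket_ofNat h' k',
      negOnePow_smul_ofNat _ (p * q) (by simp), gerstenhaber_skew k k' a b, map_neg]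
  jacobi {p q r pq qr rp s} hpq hqr hrp h1 h2 h3 a b c := by
    rcases p with p | p
    swap
    · rw [truncated_eq_zero a]; simp
    obtain ⟨a, rfl⟩ := toTruncated_surjective a
    rcases q with q | q
    swap
    · rw [truncated_eq_zero b]; simp
    obtain ⟨b, rfl⟩ := toTruncated_surjective b
    rcases r with r | r
    swap
    · rw [truncated_eq_zero c]; simp
    obtain ⟨c, rfl⟩ := toTruncated_surjective c
    obtain ⟨pq, rfl⟩ : ∃ n : ℕ, pq = Int.ofNat n := ⟨pq.toNat, by simp at hpq ⊢; omega⟩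
    obtain ⟨qr, rfl⟩ : ∃ n : ℕ, qr = Int.ofNat n := ⟨qr.toNat, by simp at hqr ⊢; omega⟩
    obtain ⟨rp, rfl⟩ : ∃ n : ℕ, rp = Int.ofNat n := ⟨rp.toNat, by simp at hrp ⊢; omega⟩
    obtain ⟨s, rfl⟩ : ∃ n : ℕ, s = Int.ofNat n := ⟨s.toNat, by simp at h1 ⊢; omega⟩
    have kpq : p + q = pq := by simp at hpq; omega
    have kqr : q + r = qr := by simp at hqr; omega
    have krp : r + p = rp := by simp at hrp; omega
    have k1 : pq + r = s := by simp at h1; omega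
    have k2 : qr + p = s := by omega
    have k3 : rp + q = s := by omega
    rw [truncatedBracket_ofNat hpq kpq, truncatedBracket_ofNat hqr kqr,
      truncatedBracket_ofNat hrp krp, truncatedBracket_ofNat h1 k1, truncatedBracket_ofNat h2 k2,
      truncatedBracket_ofNat h3 k3, negOnePow_smul_ofNat _ (p * r) (by simp),
      negOnePow_smul_ofNat _ (q * p) (by simp), negOnePow_smul_ofNat _ (r * q) (by simp),
      ← map_add, ← map_add, gerstenhaber_jacobi kpq kqr krp k1 k2 k3 a b c, map_zero]
  leibniz {p p' q q' r r'} hp hq hr h h1 h2 a b := by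
    rcases p with p | p
    swap
    · rw [truncated_eq_zero a]; simp
    obtain ⟨a, rfl⟩ := toTruncated_surjective a
    rcases q with q | q
    swap
    · rw [truncated_eq_zero b]; simp
    obtain ⟨b, rfl⟩ := toTruncated_surjective b
    obtain ⟨p', rfl⟩ : ∃ n : ℕ, p' = Int.ofNat n := ⟨p'.toNat, by simp at hp ⊢; omega⟩
    obtain ⟨q', rfl⟩ : ∃ n : ℕ, q' = Int.ofNat n := ⟨q'.toNat, by simp at hq ⊢; omega⟩
    obtain ⟨r, rfl⟩ : ∃ n : ℕ, r = Int.ofNat n := ⟨r.toNat, by simp at h ⊢; omega⟩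
    obtain ⟨r', rfl⟩ : ∃ n : ℕ, r' = Int.ofNat n := ⟨r'.toNat, by simp at hr ⊢; omega⟩
    have kp : 1 + p = p' := by simp at hp; omega
    have kq : 1 + q = q' := by simp at hq; omega
    have kr : 1 + r = r' := by simp at hr; omega
    have k : p + q = r := by simp at h; omega
    have k1 : p' + q = r' := by omega
    have k2 : p + q' = r' := by omega
    rw [truncatedBracket_ofNat h k, truncatedD_ofNat hr kr, truncatedD_ofNat hp kp,
      truncatedD_ofNat hq kq, truncatedBracket_ofNat h1 k1, truncatedBracket_ofNat h2 k2,
      negOnePow_smul_ofNat _ p (by simp), ← map_add, gerstenhaber_mul_leibniz kp kq kr k k1 k2 a b]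

end Hochschild

/-! The obstruction is of Groenewold–van Hove type. Let `x`, `y` be two of the variables and let `π
= ∂_x ∧ ∂_y`, which quantizes to a star product `m + ħπ + ħ²B` modulo `ħ³`. Over a DG Lie algebra
with zero differential, the twisted differential is just the bracket with the twisting element. A
degree-zero element commuting with `π` is then closed for `ħ[π, ·]` without any correction in `ħ`,
and such elements form a Lie algebra. Formality carries this picture to cochains. Every vector field
`v` with `[π, v] = 0` would extend to a derivation `v + ħv₁ + ħ²v₂` of some star product, compatibly
with commutators. The extension is unique: the ambiguity consists of twisted boundaries of elements
of degree `-1`, that is, of inner derivations, and the truncated complex has none.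

Applied to Hamiltonian vector fields, this would preserve the relation `2{x³, y⁴} = 3{x², xy⁴}` at
order `ħ²`. In the Moyal bracket the third-order term of the left side is a nonzero multiple of `y`,
while that of the right side vanishes. `Hochschild.no_hamiltonian_deformation` makes this a
contradiction for every star product with first-order term `π` and every choice of extensions. The
relations with `xy`, which grades monomials by weight, control the first-order corrections at the
origin. Associativity and the derivation equations then determine enough values of the second-order
terms at the origin.

To transport structures, a zigzag is first replaced by one span of surjections with acyclic kernels
(`QuasiIsomorphic.spanEquivalent`), using the path object `M[t, dt]` and fibre products. Along such
a span the Maurer-Cartan element and the closed elements are lifted order by order in `ħ`, which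
yields `SpanEquivalent.exists_deformation`. -/

namespace DGLieAlgebra

/-! ### Trivial fibrations and spans of them. -/

section Fibrations

variable {K : Type u} [Field K]

/-- A trivial fibration: a degreewise surjective morphism with acyclic kernel. -/
structure Hom.IsTrivialFibration {L M : DGLieAlgebra.{u, v} K} (f : Hom L M) : Prop where
  surjective : ∀ n, Function.Surjective (f.toFun n)
  exists_primitive : ∀ {p q r : ℤ} (h : p + 1 = q) (h' : q + 1 = r) (x : L.X q),
    L.d h' x = 0 → f.toFun q x = 0 → ∃ y, L.d h y = x ∧ f.toFun p y = 0

/-- The differential of an arbitrary lift lies in the acyclic kernel, so subtracting a primitive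
taken in the kernel makes the lift closed. -/
theorem Hom.IsTrivialFibration.exists_cocycle {L M : DGLieAlgebra.{u, v} K} {f : Hom L M}
    (hf : f.IsTrivialFibration) {p q : ℤ} (h : p + 1 = q) (y : M.X p) (hy : M.d h y = 0) :
    ∃ x, L.d h x = 0 ∧ f.toFun p x = y := by
  obtain ⟨x, rfl⟩ := hf.surjective p y
  obtain ⟨z, hz, hz'⟩ := hf.exists_primitive (p := p) h (rfl : q + 1 = q + 1) (L.d h x)
    (L.d_d _ _ _) (by rw [f.map_d, hy])
  exact ⟨x - z, by rw [map_sub, hz, sub_self], by rw [map_sub, hz', sub_zero]⟩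

/-- An arbitrary lift `w` of `y` fails to be a primitive of `x` by a cocycle of the kernel, which is
exact there. -/
theorem Hom.IsTrivialFibration.exists_primitive_lift {L M : DGLieAlgebra.{u, v} K} {f : Hom L M}
    (hf : f.IsTrivialFibration) {p q r : ℤ} (h : p + 1 = q) (h' : q + 1 = r) (x : L.X q)
    (hx : L.d h' x = 0) (y : M.X p) (hy : M.d h y = f.toFun q x) :
    ∃ z, L.d h z = x ∧ f.toFun p z = y := by
  obtain ⟨w, rfl⟩ := hf.surjective p y
  obtain ⟨z, hz, hz'⟩ := hf.exists_primitive h h' (x - L.d h w)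
    (by rw [map_sub, hx, L.d_d, sub_zero]) (by rw [map_sub, f.map_d, hy, sub_self])
  exact ⟨w + z, by rw [map_add, hz, add_sub_cancel], by rw [map_add, hz', add_zero]⟩

/-- A quasi-isomorphism reflects coboundaries. -/
theorem Hom.IsQuasiIso.exists_primitive {L M : DGLieAlgebra.{u, v} K} {f : Hom L M}
    (hf : f.IsQuasiIso) {p q r : ℤ} (h : p + 1 = q) (h' : q + 1 = r) (x : L.X q)
    (hx : L.d h' x = 0) (y : M.X p) (hy : M.d h y = f.toFun q x) : ∃ z, L.d h z = x := by
  subst h'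
  let c : L.cocycles q := ⟨x, hx⟩
  have h0 : f.cohomologyMap q (Submodule.Quotient.mk c) = 0 :=
    (Submodule.Quotient.mk_eq_zero _).2 (M.mem_coboundaries h _ y hy)
  have h1 : (Submodule.Quotient.mk c : L.H q) = 0 := (hf q).1 (by rw [h0, map_zero])
  exact L.exists_of_mem_coboundaries h c ((Submodule.Quotient.mk_eq_zero _).1 h1)

/-- A quasi-isomorphism is surjective on cocycles up to coboundaries. -/
theorem Hom.IsQuasiIso.exists_cocycle {L M : DGLieAlgebra.{u, v} K} {f : Hom L M}
    (hf : f.IsQuasiIso) {p q r : ℤ} (h : p + 1 = q) (h' : q + 1 = r) (y : M.X q)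
    (hy : M.d h' y = 0) : ∃ x w, L.d h' x = 0 ∧ M.d h w = y - f.toFun q x := by
  subst h'
  obtain ⟨c, hc⟩ := (hf q).2 (Submodule.Quotient.mk ⟨y, hy⟩)
  induction c using Submodule.Quotient.induction_on with
  | _ c =>
  have h1 := (Submodule.Quotient.eq _).1 hc.symm
  obtain ⟨w, hw⟩ := M.exists_of_mem_coboundaries h _ h1
  exact ⟨c, w, c.2, hw⟩

/-- The identity morphism. -/
def Hom.id (L : DGLieAlgebra.{u, v} K) : Hom L L where
  toFun _ := LinearMap.id
  map_d _ _ := rfl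
  map_bracket _ _ _ := rfl

/-- Composition of morphisms. -/
def Hom.comp {L M N : DGLieAlgebra.{u, v} K} (g : Hom M N) (f : Hom L M) : Hom L N where
  toFun n := g.toFun n ∘ₗ f.toFun n
  map_d h a := by simp [f.map_d, g.map_d]
  map_bracket h a b := by simp [f.map_bracket, g.map_bracket]

theorem Hom.isTrivialFibration_id (L : DGLieAlgebra.{u, v} K) :
    (Hom.id L).IsTrivialFibration where
  surjective _ x := ⟨x, rfl⟩
  exists_primitive _ _ x _ hx := ⟨0, by rw [map_zero]; exact hx.symm, map_zero _⟩

theorem Hom.IsTrivialFibration.comp {L M N : DGLieAlgebra.{u, v} K} {g : Hom M N} {f : Hom L M}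
    (hg : g.IsTrivialFibration) (hf : f.IsTrivialFibration) :
    (g.comp f).IsTrivialFibration where
  surjective n := (hg.surjective n).comp (hf.surjective n)
  exists_primitive {p q r} h h' x hx hx' := by
    obtain ⟨y, hy, hy'⟩ := hg.exists_primitive h h' (f.toFun q x)
      (by rw [← f.map_d, hx, map_zero]) hx'
    obtain ⟨z, hz, hz'⟩ := hf.exists_primitive_lift h h' x hx y hy
    exact ⟨z, hz, by simp [Hom.comp, hz', hy']⟩

/-! ### Fibre products of DG Lie algebras. -/

section Pullback

variable {L M N : DGLieAlgebra.{u, v} K} (f : Hom L M) (g : Hom N M)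

/-- The underlying spaces of the fibre product. -/
def pullbackX (n : ℤ) : Submodule K (L.X n × N.X n) :=
  LinearMap.eqLocus (f.toFun n ∘ₗ LinearMap.fst K _ _) (g.toFun n ∘ₗ LinearMap.snd K _ _)

theorem mem_pullbackX {n : ℤ} (a : L.X n × N.X n) :
    a ∈ pullbackX f g n ↔ f.toFun n a.1 = g.toFun n a.2 := Iff.rfl

/-- The fibre product of DG Lie algebras. -/
def pullback : DGLieAlgebra.{u, v} K where
  X n := pullbackX f g n
  d {p q} h := ((L.d h).prodMap (N.d h)).restrict (fun a ha => by
    rw [mem_pullbackX] at ha ⊢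
    simp [f.map_d, g.map_d, ha])
  bracket {p q r} h := LinearMap.mk₂ K
    (fun a b => ⟨(L.bracket h a.1.1 b.1.1, N.bracket h a.1.2 b.1.2), by
      have ha := (mem_pullbackX f g _).1 a.2
      have hb := (mem_pullbackX f g _).1 b.2
      rw [mem_pullbackX]
      simp [f.map_bracket, g.map_bracket, ha, hb]⟩)
    (fun _ _ _ => Subtype.ext (by simp)) (fun _ _ _ => Subtype.ext (by simp))
    (fun _ _ _ => Subtype.ext (by simp)) (fun _ _ _ => Subtype.ext (by simp))
  d_d hq hr a := Subtype.ext (Prod.ext (L.d_d hq hr a.1.1) (N.d_d hq hr a.1.2))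
  skew h h' a b := Subtype.ext (Prod.ext (L.skew h h' a.1.1 b.1.1) (N.skew h h' a.1.2 b.1.2))
  jacobi hpq hqr hrp h1 h2 h3 a b c := Subtype.ext (Prod.ext
    (L.jacobi hpq hqr hrp h1 h2 h3 a.1.1 b.1.1 c.1.1)
    (N.jacobi hpq hqr hrp h1 h2 h3 a.1.2 b.1.2 c.1.2))
  leibniz hp hq hr h h1 h2 a b := Subtype.ext (Prod.ext
    (L.leibniz hp hq hr h h1 h2 a.1.1 b.1.1) (N.leibniz hp hq hr h h1 h2 a.1.2 b.1.2))

/-- The first projection of the fibre product. -/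
def pullbackFst : Hom (pullback f g) L where
  toFun n := LinearMap.fst K _ _ ∘ₗ (pullbackX f g n).subtype
  map_d _ _ := rfl
  map_bracket _ _ _ := rfl

/-- The second projection of the fibre product. -/
def pullbackSnd : Hom (pullback f g) N where
  toFun n := LinearMap.snd K _ _ ∘ₗ (pullbackX f g n).subtype
  map_d _ _ := rfl
  map_bracket _ _ _ := rfl

variable {f g}

/-- The kernel of the projection is a copy of the kernel of `g`. This stability under base change is
what allows spans to be composed. -/
theorem pullbackFst_isTrivialFibration (hg : g.IsTrivialFibration) :
    (pullbackFst f g).IsTrivialFibration where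
  surjective n x := by
    obtain ⟨y, hy⟩ := hg.surjective n (f.toFun n x)
    exact ⟨⟨(x, y), hy.symm⟩, rfl⟩
  exists_primitive {p q r} h h' := by
    rintro ⟨⟨x, y⟩, hxy⟩ hd (h0 : x = 0)
    subst h0
    have hy : g.toFun q y = 0 := by
      rw [mem_pullbackX] at hxy
      simpa using hxy.symm
    obtain ⟨z, hz, hz'⟩ := hg.exists_primitive h h' y (congrArg (fun a => a.1.2) hd) hy
    exact ⟨⟨(0, z), by rw [mem_pullbackX]; simp [hz']⟩,
      Subtype.ext (Prod.ext (L.d h).map_zero hz), rfl⟩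

theorem pullbackSnd_isTrivialFibration (hf : f.IsTrivialFibration) :
    (pullbackSnd f g).IsTrivialFibration where
  surjective n y := by
    obtain ⟨x, hx⟩ := hf.surjective n (g.toFun n y)
    exact ⟨⟨(x, y), hx⟩, rfl⟩
  exists_primitive {p q r} h h' := by
    rintro ⟨⟨x, y⟩, hxy⟩ hd (h0 : y = 0)
    subst h0
    have hx : f.toFun q x = 0 := by
      rw [mem_pullbackX] at hxy
      simpa using hxy
    obtain ⟨z, hz, hz'⟩ := hf.exists_primitive h h' x (congrArg (fun a => a.1.1) hd) hx
    exact ⟨⟨(z, 0), by rw [mem_pullbackX]; simp [hz']⟩,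
      Subtype.ext (Prod.ext hz (N.d h).map_zero), rfl⟩

end Pullback

/-- Two DG Lie algebras are connected by a span of trivial fibrations. -/
def SpanEquivalent (L M : DGLieAlgebra.{u, v} K) : Prop :=
  ∃ (N : DGLieAlgebra.{u, v} K) (p : Hom N L) (q : Hom N M),
    p.IsTrivialFibration ∧ q.IsTrivialFibration

theorem SpanEquivalent.refl (L : DGLieAlgebra.{u, v} K) : SpanEquivalent L L :=
  ⟨L, Hom.id L, Hom.id L, Hom.isTrivialFibration_id L, Hom.isTrivialFibration_id L⟩

theorem SpanEquivalent.symm {L M : DGLieAlgebra.{u, v} K} :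
    SpanEquivalent L M → SpanEquivalent M L :=
  fun ⟨N, p, q, hp, hq⟩ => ⟨N, q, p, hq, hp⟩

theorem SpanEquivalent.trans {L M N : DGLieAlgebra.{u, v} K} :
    SpanEquivalent L M → SpanEquivalent M N → SpanEquivalent L N :=
  fun ⟨_, p, q, hp, hq⟩ ⟨_, p', q', hp', hq'⟩ =>
    ⟨pullback q p', p.comp (pullbackFst q p'), q'.comp (pullbackSnd q p'),
      hp.comp (pullbackFst_isTrivialFibration hp'), hq'.comp (pullbackSnd_isTrivialFibration hq)⟩

end Fibrations

/-! ### Calculus of polynomials with vector coefficients. -/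

section Path

open Polynomial TensorProduct

variable {K : Type u} [Field K]

/-- Antiderivative of polynomials, with constant term zero. -/
noncomputable def polynomialIntegral : K[X] →ₗ[K] K[X] :=
  Polynomial.lsum fun n => (monomial (n + 1)) ∘ₗ LinearMap.mulLeft K ((n + 1 : K)⁻¹)

theorem polynomialIntegral_monomial (n : ℕ) (c : K) :
    polynomialIntegral (monomial n c) = monomial (n + 1) ((n + 1 : K)⁻¹ * c) := by
  simp [polynomialIntegral, Polynomial.lsum, Polynomial.sum_monomial_index]

/-- Each `n + 1` must be invertible: this is where characteristic zero enters the replacement of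
quasi-isomorphisms by spans. -/
theorem derivative_comp_integral [CharZero K] :
    (derivative : K[X] →ₗ[K] K[X]) ∘ₗ polynomialIntegral = LinearMap.id := by
  refine Polynomial.lhom_ext' fun n => LinearMap.ext fun c => ?_
  have : (n + 1 : K) ≠ 0 := by exact_mod_cast n.succ_ne_zero
  simp only [LinearMap.comp_apply, polynomialIntegral_monomial, derivative_monomial,
    LinearMap.id_apply]
  congr 1
  push_cast
  field_simp

theorem integral_comp_derivative [CharZero K] :
    polynomialIntegral ∘ₗ (derivative : K[X] →ₗ[K] K[X])
      = LinearMap.id - (Algebra.linearMap K K[X]) ∘ₗ leval 0 := by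
  refine Polynomial.lhom_ext' fun n => LinearMap.ext fun c => ?_
  rcases n with _ | n
  · simp
  · have : (n + 1 : K) ≠ 0 := by exact_mod_cast n.succ_ne_zero
    simp only [LinearMap.comp_apply, polynomialIntegral_monomial, derivative_monomial,
      LinearMap.id_apply, LinearMap.sub_apply]
    simp only [Nat.add_sub_cancel]
    simp
    field_simp

theorem leval_zero_comp_integral :
    leval (0 : K) ∘ₗ polynomialIntegral = 0 := by
  refine Polynomial.lhom_ext' fun n => LinearMap.ext fun c => ?_
  simp [polynomialIntegral_monomial]

variable {V W U : Type*} [AddCommGroup V] [Module K V] [AddCommGroup W] [Module K W]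
  [AddCommGroup U] [Module K U]

/-- Extension of a bilinear map to polynomials with vector coefficients. -/
noncomputable def polyMul (β : V →ₗ[K] W →ₗ[K] U) : K[X] ⊗[K] V →ₗ[K] K[X] ⊗[K] W →ₗ[K] K[X] ⊗[K] U :=
  TensorProduct.map₂ (LinearMap.mul K K[X]) β

@[simp]
theorem polyMul_tmul (β : V →ₗ[K] W →ₗ[K] U) (f g : K[X]) (a : V) (b : W) :
    polyMul β (f ⊗ₜ a) (g ⊗ₜ b) = (f * g) ⊗ₜ β a b := by
  simp [polyMul]

/-- Derivative of polynomials with vector coefficients. -/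
noncomputable def polyDeriv : K[X] ⊗[K] V →ₗ[K] K[X] ⊗[K] V :=
  LinearMap.rTensor V derivative

/-- Antiderivative of polynomials with vector coefficients. -/
noncomputable def polyInt : K[X] ⊗[K] V →ₗ[K] K[X] ⊗[K] V :=
  LinearMap.rTensor V polynomialIntegral

/-- Evaluation of polynomials with vector coefficients. -/
noncomputable def polyEval (c : K) : K[X] ⊗[K] V →ₗ[K] V :=
  (TensorProduct.lid K V).toLinearMap ∘ₗ LinearMap.rTensor V (leval c)

/-- Constant polynomials with vector coefficients. -/
noncomputable def polyConst : V →ₗ[K] K[X] ⊗[K] V := TensorProduct.mk K K[X] V 1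

@[simp]
theorem polyDeriv_tmul (f : K[X]) (a : V) : polyDeriv (f ⊗ₜ[K] a) = derivative f ⊗ₜ a := rfl

@[simp]
theorem polyInt_tmul (f : K[X]) (a : V) :
    polyInt (f ⊗ₜ[K] a) = polynomialIntegral f ⊗ₜ a := rfl

@[simp]
theorem polyEval_tmul (c : K) (f : K[X]) (a : V) : polyEval c (f ⊗ₜ[K] a) = f.eval c • a := by
  simp [polyEval]

theorem polyDeriv_polyInt [CharZero K] (x : K[X] ⊗[K] V) : polyDeriv (polyInt x) = x := by
  rw [polyDeriv, polyInt, ← LinearMap.comp_apply, ← LinearMap.rTensor_comp,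
    derivative_comp_integral, LinearMap.rTensor_id, LinearMap.id_apply]

theorem polyInt_polyDeriv [CharZero K] (x : K[X] ⊗[K] V) :
    polyInt (polyDeriv x) = x - polyConst (polyEval 0 x) := by
  induction x using TensorProduct.induction_on with
  | zero => simp
  | tmul f a =>
    have := LinearMap.congr_fun (integral_comp_derivative (K := K)) f
    simp only [LinearMap.comp_apply, LinearMap.sub_apply, LinearMap.id_apply] at this
    rw [polyDeriv_tmul, polyInt_tmul, this, TensorProduct.sub_tmul, polyEval_tmul, polyConst,
      TensorProduct.mk_apply, ← TensorProduct.smul_tmul]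
    simp [Algebra.smul_def]
  | add x y hx hy => simp only [map_add, hx, hy]; abel

theorem polyEval_zero_polyInt (x : K[X] ⊗[K] V) : polyEval 0 (polyInt x) = 0 := by
  induction x using TensorProduct.induction_on with
  | zero => simp
  | tmul f a =>
    have := LinearMap.congr_fun (leval_zero_comp_integral (K := K)) f
    simp only [LinearMap.comp_apply, leval_apply, LinearMap.zero_apply] at this
    simp [this]
  | add x y hx hy => simp only [map_add, hx, hy, add_zero]

theorem polyEval_polyMul (c : K) (β : V →ₗ[K] W →ₗ[K] U) (x : K[X] ⊗[K] V) (y : K[X] ⊗[K] W) :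
    polyEval c (polyMul β x y) = β (polyEval c x) (polyEval c y) := by
  induction x using TensorProduct.induction_on with
  | zero => simp
  | add x x' hx hx' => simp only [map_add, LinearMap.add_apply, hx, hx']
  | tmul f a =>
  induction y using TensorProduct.induction_on with
  | zero => simp
  | add y y' hy hy' => simp only [map_add, hy, hy']
  | tmul g b => simp [smul_smul, mul_comm]

theorem polyEval_lTensor (c : K) (φ : V →ₗ[K] W) (x : K[X] ⊗[K] V) :
    polyEval c (LinearMap.lTensor K[X] φ x) = φ (polyEval c x) := by
  induction x using TensorProduct.induction_on with
  | zero => simp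
  | add x x' hx hx' => simp only [map_add, hx, hx']
  | tmul f a => simp

theorem polyDeriv_lTensor (φ : V →ₗ[K] W) (x : K[X] ⊗[K] V) :
    polyDeriv (LinearMap.lTensor K[X] φ x) = LinearMap.lTensor K[X] φ (polyDeriv x) := by
  induction x using TensorProduct.induction_on with
  | zero => simp
  | add x x' hx hx' => simp only [map_add, hx, hx']
  | tmul f a => simp

theorem polyInt_lTensor (φ : V →ₗ[K] W) (x : K[X] ⊗[K] V) :
    polyInt (LinearMap.lTensor K[X] φ x) = LinearMap.lTensor K[X] φ (polyInt x) := by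
  induction x using TensorProduct.induction_on with
  | zero => simp
  | add x x' hx hx' => simp only [map_add, hx, hx']
  | tmul f a => simp

@[simp]
theorem lTensor_polyConst (φ : V →ₗ[K] W) (a : V) :
    LinearMap.lTensor K[X] φ (polyConst a) = polyConst (φ a) := rfl

@[simp]
theorem polyDeriv_polyConst (a : V) : polyDeriv (polyConst a : K[X] ⊗[K] V) = 0 := by
  simp [polyConst]

@[simp]
theorem polyEval_polyConst (c : K) (a : V) : polyEval c (polyConst a : K[X] ⊗[K] V) = a := by
  simp [polyConst]

end Path

/-! ### Tensor and degree bookkeeping. -/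

section Casts

open Polynomial TensorProduct

variable {K : Type u} [Field K]

theorem tmul_units_smul {R V W : Type*} [CommRing R] [AddCommGroup V] [Module R V] [AddCommGroup W]
    [Module R W] (u : ℤˣ) (x : V) (y : W) : x ⊗ₜ[R] (u • y) = u • (x ⊗ₜ[R] y) := by
  rcases Int.units_eq_one_or u with rfl | rfl <;> simp [tmul_neg]

/-- The identities in `M[t, dt]` are additive in each argument, so it suffices to check them on
terms `f(t) a` and `f(t) b dt`. -/
theorem tmul_prod_induction {V W : Type*} [AddCommGroup V] [Module K V] [AddCommGroup W]
    [Module K W] {P : (K[X] ⊗[K] V) × (K[X] ⊗[K] W) → Prop}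
    (add : ∀ x y, P x → P y → P (x + y)) (left : ∀ f a, P (f ⊗ₜ a, 0))
    (right : ∀ f b, P (0, f ⊗ₜ b)) (x : (K[X] ⊗[K] V) × (K[X] ⊗[K] W)) : P x := by
  obtain ⟨x, y⟩ := x
  have hx : P (x, 0) := by
    induction x using TensorProduct.induction_on with
    | zero => simpa using left 0 0
    | tmul f a => exact left f a
    | add x x' hx hx' => simpa using add _ _ hx hx'
  have hy : P (0, y) := by
    induction y using TensorProduct.induction_on with
    | zero => simpa using right 0 0
    | tmul f a => exact right f a
    | add x x' hx hx' => simpa using add _ _ hx hx'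
  simpa using add _ _ hx hy

variable (M : DGLieAlgebra.{u, v} K)

/-- Transport along an equality of degrees. -/
def cast {p q : ℤ} (h : p = q) : M.X p →ₗ[K] M.X q := h ▸ LinearMap.id

@[simp]
theorem cast_rfl {p : ℤ} (h : p = p) (a : M.X p) : M.cast h a = a := rfl

@[simp]
theorem d_cast {p p' q : ℤ} (e : p = p') (h : p' + 1 = q) (a : M.X p) :
    M.d h (M.cast e a) = M.d (by omega) a := by subst e; rfl

@[simp]
theorem bracket_cast_left {p p' q r : ℤ} (e : p = p') (h : p' + q = r) (a : M.X p) (b : M.X q) :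
    M.bracket h (M.cast e a) b = M.bracket (by omega) a b := by subst e; rfl

@[simp]
theorem bracket_cast_right {p q q' r : ℤ} (e : q = q') (h : p + q' = r) (a : M.X p) (b : M.X q) :
    M.bracket h a (M.cast e b) = M.bracket (by omega) a b := by subst e; rfl

@[simp]
theorem cast_bracket {p q r r' : ℤ} (e : r = r') (h : p + q = r) (a : M.X p) (b : M.X q) :
    M.cast e (M.bracket h a b) = M.bracket (by omega) a b := by subst e; rfl

@[simp]
theorem cast_d {p q q' : ℤ} (e : q = q') (h : p + 1 = q) (a : M.X p) :
    M.cast e (M.d h a) = M.d (by omega) a := by subst e; rfl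

end Casts

/-! ### The DG Lie structure of `M[t, dt]`. -/

section PathObject

open Polynomial TensorProduct

variable {K : Type u} [Field K] (M : DGLieAlgebra.{u, u} K)

/-- Degree `n` of `M[t, dt]`: pairs `(a, b)` standing for `a(t) + b(t) dt`. -/
abbrev PathX (n : ℤ) : Type u := (K[X] ⊗[K] M.X n) × (K[X] ⊗[K] M.X (n - 1))

/-- The differential of `M[t, dt]`. -/
noncomputable def pathD {p q : ℤ} (h : p + 1 = q) : M.PathX p →ₗ[K] M.PathX q :=
  LinearMap.prod ((M.d h).lTensor K[X] ∘ₗ LinearMap.fst K _ _)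
    ((M.d (by omega : p - 1 + 1 = q - 1)).lTensor K[X] ∘ₗ LinearMap.snd K _ _
      -- With `dt` written to the right of its coefficient, differentiation in `t` contributes
      -- `(-1)^p a'(t) dt`. The cast identifies the degrees `p` and `q - 1`.
      + ((p.negOnePow : ℤˣ) : ℤ) •
        (M.cast (by omega : p = q - 1)).lTensor K[X] ∘ₗ polyDeriv ∘ₗ LinearMap.fst K _ _)

theorem pathD_apply {p q : ℤ} (h : p + 1 = q) (x : M.PathX p) :
    M.pathD h x = ((M.d h).lTensor K[X] x.1,
      (M.d (by omega : p - 1 + 1 = q - 1)).lTensor K[X] x.2 + p.negOnePow •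
        (M.cast (by omega : p = q - 1)).lTensor K[X] (polyDeriv x.1)) := rfl

/-- The bracket of `M[t, dt]`. -/
noncomputable def pathBracket {p q r : ℤ} (h : p + q = r) :
    M.PathX p →ₗ[K] M.PathX q →ₗ[K] M.PathX r :=
  LinearMap.mk₂ K (fun x y => (polyMul (M.bracket h) x.1 y.1,
      polyMul (M.bracket (by omega : p + (q - 1) = r - 1)) x.1 y.2
        -- Moving `dt` to the right past an element of degree `q` costs `(-1)^q`.
        + q.negOnePow • polyMul (M.bracket (by omega : p - 1 + q = r - 1)) x.2 y.1))
    (fun x x' y => by ext <;> simp [smul_add]; abel)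
    (fun c x y => by ext <;> simp [smul_add, smul_comm c])
    (fun x y y' => by ext <;> simp [smul_add]; abel)
    (fun c x y => by ext <;> simp [smul_add, smul_comm c])

theorem pathBracket_apply {p q r : ℤ} (h : p + q = r) (x : M.PathX p) (y : M.PathX q) :
    M.pathBracket h x y = (polyMul (M.bracket h) x.1 y.1,
      polyMul (M.bracket (by omega : p + (q - 1) = r - 1)) x.1 y.2
        + q.negOnePow • polyMul (M.bracket (by omega : p - 1 + q = r - 1)) x.2 y.1) := rfl

theorem pathD_pathD {p q r : ℤ} (hq : p + 1 = q) (hr : q + 1 = r) (x : M.PathX p) :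
    M.pathD hr (M.pathD hq x) = 0 := by
  induction x using tmul_prod_induction with
  | add x y hx hy => rw [map_add, map_add, hx, hy, add_zero]
  | left f a =>
    subst hq
    simp [pathD_apply, M.d_d, Int.negOnePow_add]
  | right f b => simp [pathD_apply, M.d_d]

theorem pathBracket_skew {p q r : ℤ} (h : p + q = r) (h' : q + p = r) (x : M.PathX p)
    (y : M.PathX q) :
    M.pathBracket h x y = -((p * q).negOnePow • M.pathBracket h' y x) := by
  induction x using tmul_prod_induction with
  | add x x' hx hx' =>
    rw [map_add, LinearMap.add_apply, hx, hx', map_add, smul_add, neg_add]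
  | left f a =>
    induction y using tmul_prod_induction with
    | add y y' hy hy' =>
      rw [map_add, map_add, LinearMap.add_apply, hy, hy', smul_add, neg_add]
    | left g b =>
      ext
      · simp only [pathBracket_apply, polyMul_tmul, M.skew h h' a b, mul_comm f g]
        rcases Int.units_eq_one_or (p * q).negOnePow with e | e <;> simp [e, tmul_neg]
      · simp [pathBracket_apply]
    | right g b =>
      ext
      · simp [pathBracket_apply]
      · simp [pathBracket_apply]
        rw [M.skew _ (by omega : q - 1 + p = r - 1) a b, mul_comm f g, mul_sub, Int.negOnePow_sub]
        rcases Int.units_eq_one_or p.negOnePow with e | e <;>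
        rcases Int.units_eq_one_or (p * q).negOnePow with e' | e' <;> simp [e, e', tmul_neg]
  | right f a =>
    induction y using tmul_prod_induction with
    | add y y' hy hy' =>
      rw [map_add, map_add, LinearMap.add_apply, hy, hy', smul_add, neg_add]
    | left g b =>
      ext
      · simp [pathBracket_apply]
      · simp [pathBracket_apply]
        rw [M.skew _ (by omega : q + (p - 1) = r - 1) a b, mul_comm f g, sub_mul, Int.negOnePow_sub]
        rcases Int.units_eq_one_or q.negOnePow with e | e <;>
        rcases Int.units_eq_one_or (p * q).negOnePow with e' | e' <;> simp [e, e', tmul_neg]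
    | right g b =>
      ext
      · simp [pathBracket_apply]
      · simp [pathBracket_apply]

-- Commutativity of `K[t]` reduces everything to the Jacobi identity of `M`, which is `key`. Terms
-- with two or more factors `dt` vanish. Terms with a single `dt` are `key` with the degree of that
-- argument lowered by one, up to a common sign.
set_option maxHeartbeats 1000000 in
theorem pathBracket_jacobi {p q r pq qr rp s : ℤ} (hpq : p + q = pq) (hqr : q + r = qr)
    (hrp : r + p = rp) (h1 : pq + r = s) (h2 : qr + p = s) (h3 : rp + q = s) (x : M.PathX p)
    (y : M.PathX q) (z : M.PathX r) :
    (p * r).negOnePow • M.pathBracket h1 (M.pathBracket hpq x y) z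
      + (q * p).negOnePow • M.pathBracket h2 (M.pathBracket hqr y z) x
      + (r * q).negOnePow • M.pathBracket h3 (M.pathBracket hrp z x) y = 0 := by
  have key : ∀ {p q r pq qr rp s : ℤ} (hpq : p + q = pq) (hqr : q + r = qr)
      (hrp : r + p = rp) (h1 : pq + r = s) (h2 : qr + p = s) (h3 : rp + q = s) (f g k : K[X])
      (a : M.X p) (b : M.X q) (c : M.X r),
      (p * r).negOnePow • ((f * g * k) ⊗ₜ[K] M.bracket h1 (M.bracket hpq a b) c)
      + (q * p).negOnePow • ((g * k * f) ⊗ₜ[K] M.bracket h2 (M.bracket hqr b c) a)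
      + (r * q).negOnePow • ((k * f * g) ⊗ₜ[K] M.bracket h3 (M.bracket hrp c a) b) = 0 := by
    intro p q r pq qr rp s hpq hqr hrp h1 h2 h3 f g k a b c
    have J := congrArg (fun z => (f * g * k) ⊗ₜ[K] z) (M.jacobi hpq hqr hrp h1 h2 h3 a b c)
    rw [show g * k * f = f * g * k by ring, show k * f * g = f * g * k by ring]
    simpa only [tmul_add, tmul_zero, tmul_units_smul] using J
  induction x using tmul_prod_induction with
  | add x x' hx hx' =>
    have := congrArg₂ (· + ·) hx hx'
    simp only [add_zero] at this
    rw [← this]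
    simp only [map_add, LinearMap.add_apply, smul_add]
    abel
  | left f a =>
    induction y using tmul_prod_induction with
    | add x x' hx hx' =>
      have := congrArg₂ (· + ·) hx hx'
      simp only [add_zero] at this
      rw [← this]
      simp only [map_add, LinearMap.add_apply, smul_add]
      abel
    | left g b =>
      induction z using tmul_prod_induction with
      | add x x' hx hx' =>
        have := congrArg₂ (· + ·) hx hx'
        simp only [add_zero] at this
        rw [← this]
        simp only [map_add, LinearMap.add_apply, smul_add]
        abel
      | left k c =>
        ext
        · simpa [pathBracket_apply] using key hpq hqr hrp h1 h2 h3 f g k a b c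
        · simp [pathBracket_apply]
      | right k c =>
        ext
        · simp [pathBracket_apply]
        · have J := key hpq (by omega : q + (r - 1) = qr - 1) (by omega : r - 1 + p = rp - 1)
            (by omega : pq + (r - 1) = s - 1) (by omega) (by omega) f g k a b c
          subst hrp hqr hpq
          simp [pathBracket_apply, mul_sub, sub_mul, Int.negOnePow_sub] at J ⊢
          rcases Int.units_eq_one_or p.negOnePow with e | e <;>
          rcases Int.units_eq_one_or q.negOnePow with e' | e' <;>
          simp only [e, e', one_smul, Units.neg_smul, smul_neg, mul_one, mul_neg] at J ⊢ <;> first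
          | (refine Eq.trans ?_ J; abel1)
          | (refine neg_eq_zero.1 (Eq.trans ?_ J); abel)
    | right g b =>
      induction z using tmul_prod_induction with
      | add x x' hx hx' =>
        have := congrArg₂ (· + ·) hx hx'
        simp only [add_zero] at this
        rw [← this]
        simp only [map_add, LinearMap.add_apply, smul_add]
        abel
      | left k c =>
        ext
        · simp [pathBracket_apply]
        · have J := key (by omega : p + (q - 1) = pq - 1) (by omega : q - 1 + r = qr - 1) hrp
            (by omega) (by omega) (by omega : rp + (q - 1) = s - 1) f g k a b c
          subst hrp hqr hpq
          simp [pathBracket_apply, mul_sub, sub_mul, Int.negOnePow_sub] at J ⊢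
          rcases Int.units_eq_one_or p.negOnePow with e | e <;>
          rcases Int.units_eq_one_or r.negOnePow with e' | e' <;>
          simp only [e, e', one_smul, Units.neg_smul, smul_neg, mul_one, mul_neg] at J ⊢ <;> first
          | (refine Eq.trans ?_ J; abel1)
          | (refine neg_eq_zero.1 (Eq.trans ?_ J); abel)
      | right k c => ext <;> simp [pathBracket_apply]
  | right f a =>
    induction y using tmul_prod_induction with
    | add x x' hx hx' =>
      have := congrArg₂ (· + ·) hx hx'
      simp only [add_zero] at this
      rw [← this]
      simp only [map_add, LinearMap.add_apply, smul_add]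
      abel
    | left g b =>
      induction z using tmul_prod_induction with
      | add x x' hx hx' =>
        have := congrArg₂ (· + ·) hx hx'
        simp only [add_zero] at this
        rw [← this]
        simp only [map_add, LinearMap.add_apply, smul_add]
        abel
      | left k c =>
        ext
        · simp [pathBracket_apply]
        · have J := key (by omega : p - 1 + q = pq - 1) hqr (by omega : r + (p - 1) = rp - 1)
            (by omega) (by omega : qr + (p - 1) = s - 1) (by omega) f g k a b c
          subst hrp hqr hpq
          simp [pathBracket_apply, mul_sub, sub_mul, Int.negOnePow_sub] at J ⊢
          rcases Int.units_eq_one_or q.negOnePow with e | e <;>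
          rcases Int.units_eq_one_or r.negOnePow with e' | e' <;>
          simp only [e, e', one_smul, Units.neg_smul, smul_neg, mul_one, mul_neg] at J ⊢ <;> first
          | (refine Eq.trans ?_ J; abel1)
          | (refine neg_eq_zero.1 (Eq.trans ?_ J); abel)
      | right k c => ext <;> simp [pathBracket_apply]
    | right g b =>
      induction z using tmul_prod_induction with
      | add x x' hx hx' =>
        have := congrArg₂ (· + ·) hx hx'
        simp only [add_zero] at this
        rw [← this]
        simp only [map_add, LinearMap.add_apply, smul_add]
        abel
      | left k c => ext <;> simp [pathBracket_apply]
      | right k c => ext <;> simp [pathBracket_apply]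

/-- When neither argument contains `dt`, the `dt`-component is the product rule in `t`. The
remaining components come from the Leibniz rule of `M`, with the degree of the `dt` argument lowered
by one, or vanish. -/
theorem pathD_pathBracket {p p' q q' r r' : ℤ} (hp : p + 1 = p') (hq : q + 1 = q')
    (hr : r + 1 = r') (h : p + q = r) (h1 : p' + q = r') (h2 : p + q' = r') (x : M.PathX p)
    (y : M.PathX q) :
    M.pathD hr (M.pathBracket h x y) = M.pathBracket h1 (M.pathD hp x) y
      + p.negOnePow • M.pathBracket h2 x (M.pathD hq y) := by
  have key : ∀ {p p' q q' r r' : ℤ} (hp : p + 1 = p') (hq : q + 1 = q')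
      (hr : r + 1 = r') (h : p + q = r) (h1 : p' + q = r') (h2 : p + q' = r') (f g : K[X])
      (a : M.X p) (b : M.X q),
      (f * g) ⊗ₜ[K] M.d hr (M.bracket h a b) = (f * g) ⊗ₜ[K] M.bracket h1 (M.d hp a) b
        + p.negOnePow • ((f * g) ⊗ₜ[K] M.bracket h2 a (M.d hq b)) := by
    intro p p' q q' r r' hp hq hr h h1 h2 f g a b
    rw [M.leibniz hp hq hr h h1 h2, tmul_add, tmul_units_smul]
  induction x using tmul_prod_induction with
  | add x x' hx hx' =>
    simp only [map_add, LinearMap.add_apply, smul_add, hx, hx']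
    abel
  | left f a =>
    induction y using tmul_prod_induction with
    | add y y' hy hy' =>
      simp only [map_add, smul_add, hy, hy']
      abel
    | left g b =>
      ext
      · simpa [pathBracket_apply, pathD_apply] using key hp hq hr h h1 h2 f g a b
      · subst h hp hq
        rcases Int.units_eq_one_or p.negOnePow with e | e <;>
        rcases Int.units_eq_one_or q.negOnePow with e' | e' <;>
        simp [pathBracket_apply, pathD_apply, Int.negOnePow_add, e, e', add_tmul, mul_comm]
    | right g b =>
      ext
      · simp [pathBracket_apply, pathD_apply]
      · simpa [pathBracket_apply, pathD_apply] using key hp (by omega : q - 1 + 1 = q' - 1)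
          (by omega : r - 1 + 1 = r' - 1) (by omega) (by omega) (by omega) f g a b
  | right f a =>
    induction y using tmul_prod_induction with
    | add y y' hy hy' =>
      simp only [map_add, smul_add, hy, hy']
      abel
    | left g b =>
      ext
      · simp [pathBracket_apply, pathD_apply]
      · have J := key (by omega : p - 1 + 1 = p' - 1) hq (by omega : r - 1 + 1 = r' - 1)
          (by omega) (by omega) (by omega) f g a b
        subst h hp hq
        rcases Int.units_eq_one_or p.negOnePow with e | e <;>
        rcases Int.units_eq_one_or q.negOnePow with e' | e' <;>
        simp [pathBracket_apply, pathD_apply, Int.negOnePow_add, e, e',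
          sub_eq_add_neg] at J ⊢ <;>
        rw [J] <;> abel
    | right g b => ext <;> simp [pathBracket_apply, pathD_apply]

end PathObject

/-! ### Path objects turn quasi-isomorphisms into spans. -/

section PathFibration

open Polynomial TensorProduct

variable {K : Type u} [Field K] (M : DGLieAlgebra.{u, u} K)

/-- The path object `M[t, dt]`. -/
noncomputable def path : DGLieAlgebra.{u, u} K where
  X := M.PathX
  d := M.pathD
  bracket := M.pathBracket
  d_d := M.pathD_pathD
  skew := M.pathBracket_skew
  jacobi := M.pathBracket_jacobi
  leibniz := M.pathD_pathBracket

/-- Evaluation of paths at a point. -/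
noncomputable def pathEval (c : K) : Hom M.path M where
  toFun _ := polyEval c ∘ₗ LinearMap.fst K _ _
  map_d h x := polyEval_lTensor c (M.d h) x.1
  map_bracket h x y := polyEval_polyMul c (M.bracket h) x.1 y.1

/-- The constant path. -/
noncomputable def pathConst (n : ℤ) : M.X n →ₗ[K] M.path.X n :=
  (LinearMap.inl K _ _ ∘ₗ polyConst : M.X n →ₗ[K] M.PathX n)

theorem pathEval_pathConst (c : K) {n : ℤ} (a : M.X n) :
    (M.pathEval c).toFun n (M.pathConst n a) = a := polyEval_polyConst c a

theorem path_d_pathConst {p q : ℤ} (h : p + 1 = q) (a : M.X p) :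
    M.path.d h (M.pathConst p a) = M.pathConst q (M.d h a) := by
  change M.pathD h (polyConst a, 0) = (polyConst (M.d h a), 0)
  rw [pathD_apply]
  simp

/-- The linear path from zero. -/
noncomputable def pathLinear (n : ℤ) : M.X n →ₗ[K] M.path.X n :=
  (LinearMap.inl K _ _ ∘ₗ TensorProduct.mk K K[X] _ Polynomial.X : M.X n →ₗ[K] M.PathX n)

theorem pathEval_pathLinear (c : K) {n : ℤ} (a : M.X n) :
    (M.pathEval c).toFun n (M.pathLinear n a) = c • a := by
  change polyEval c (Polynomial.X ⊗ₜ[K] a) = c • a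
  simp

/-- The primitive, up to its initial value, of a closed path. -/
noncomputable def pathPrimitive {p q : ℤ} (h : p + 1 = q) (x : M.path.X q) : M.path.X p :=
  ((p.negOnePow • (M.cast (by omega : q - 1 = p)).lTensor K[X] (polyInt (x : M.PathX q).2), 0)
    : M.PathX p)

theorem lTensor_cast_cast {p q : ℤ} (h : p = q) (h' : q = p) (x : K[X] ⊗[K] M.X p) :
    (M.cast h').lTensor K[X] ((M.cast h).lTensor K[X] x) = x := by
  subst h
  change LinearMap.lTensor K[X] LinearMap.id (LinearMap.lTensor K[X] LinearMap.id x) = x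
  simp

theorem lTensor_d_cast {p p' q q' : ℤ} (e : p = p') (e' : q' = q) (h : p' + 1 = q) (h' : p + 1 = q')
    (x : K[X] ⊗[K] M.X p) :
    (M.d h).lTensor K[X] ((M.cast e).lTensor K[X] x)
      = (M.cast e').lTensor K[X] ((M.d h').lTensor K[X] x) := by
  subst e e'
  change LinearMap.lTensor K[X] (M.d h) (LinearMap.lTensor K[X] LinearMap.id x)
    = LinearMap.lTensor K[X] LinearMap.id (LinearMap.lTensor K[X] (M.d h') x)
  simp

/-- This is the Poincaré lemma on the line. Closedness of `a + b dt` says that `d b` is `(-1)^p a'`,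
so `d` of the antiderivative of `b` is `(-1)^p (a - a(0))`, while its `t`-derivative is `b` again.
-/
theorem path_d_pathPrimitive [CharZero K] {p q r : ℤ} (h : p + 1 = q) (h' : q + 1 = r)
    (x : M.path.X q) (hx : M.path.d h' x = 0) :
    M.path.d h (M.pathPrimitive h x) = x - M.pathConst q ((M.pathEval 0).toFun q x) := by
  obtain ⟨a, b⟩ := x
  have hp : q.negOnePow = - p.negOnePow := by rw [← h, Int.negOnePow_succ]
  have hd : (M.d (by omega : q - 1 + 1 = r - 1)).lTensor K[X] b
      = p.negOnePow • (M.cast (by omega : q = r - 1)).lTensor K[X] (polyDeriv a) := by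
    have h2 := congrArg Prod.snd (show M.pathD h' (a, b) = 0 from hx)
    rw [pathD_apply, Prod.snd_zero] at h2
    rw [hp, Units.neg_smul] at h2
    exact add_neg_eq_zero.1 h2
  have h3 : (M.d h).lTensor K[X] ((M.cast (by omega : q - 1 = p)).lTensor K[X] (polyInt b))
      = p.negOnePow • (a - polyConst (polyEval 0 a)) := by
    rw [M.lTensor_d_cast _ (by omega : r - 1 = q) h (by omega), ← polyInt_lTensor, hd,
      Units.smul_def, map_zsmul, map_zsmul, polyInt_lTensor, lTensor_cast_cast, polyInt_polyDeriv]
    rfl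
  have h4 : (M.cast (by omega : p = q - 1)).lTensor K[X]
      (polyDeriv ((M.cast (by omega : q - 1 = p)).lTensor K[X] (polyInt b))) = b := by
    rw [polyDeriv_lTensor, polyDeriv_polyInt, lTensor_cast_cast]
  have e : (p.negOnePow : ℤ) * p.negOnePow = 1 := by
    rcases Int.units_eq_one_or p.negOnePow with e | e <;> simp [e]
  change M.pathD h (p.negOnePow • _, 0) = (a - polyConst (polyEval 0 a), b - 0)
  rw [pathD_apply]
  simp only [map_zero, zero_add, sub_zero, Units.smul_def, map_zsmul]
  rw [h3, h4, Units.smul_def, smul_smul, smul_smul, e, one_smul, one_smul]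

theorem pathEval_zero_pathPrimitive {p q : ℤ} (h : p + 1 = q) (x : M.path.X q) :
    (M.pathEval 0).toFun p (M.pathPrimitive h x) = 0 := by
  change polyEval 0 (p.negOnePow • _) = 0
  rw [Units.smul_def, map_zsmul, polyEval_lTensor, polyEval_zero_polyInt, map_zero, smul_zero]

theorem pathEval_isTrivialFibration [CharZero K] : (M.pathEval 0).IsTrivialFibration where
  surjective n a := ⟨M.pathConst n a, M.pathEval_pathConst 0 a⟩
  exists_primitive h h' x hx hx' := by
    refine ⟨M.pathPrimitive h x, ?_, M.pathEval_zero_pathPrimitive h x⟩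
    rw [M.path_d_pathPrimitive h h' x hx, hx', map_zero, sub_zero]

variable {M}

/-- A quasi-isomorphism is a span of trivial fibrations in characteristic zero. -/
theorem Hom.IsQuasiIso.spanEquivalent [CharZero K] {L : DGLieAlgebra.{u, u} K} {f : Hom L M}
    (hf : f.IsQuasiIso) : SpanEquivalent L M := by
  -- The mapping path space: pairs `(l, γ)` with `f l = γ(0)`, projected to `l` and to the endpoint
  -- `γ(1)`.
  refine ⟨pullback f (M.pathEval 0), pullbackFst f _, (M.pathEval 1).comp (pullbackSnd f _),
    pullbackFst_isTrivialFibration M.pathEval_isTrivialFibration, ?_, ?_⟩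
  · intro n a
    -- The path `t a` runs from `0` to `a`, so it lies over `l = 0`.
    refine ⟨⟨(0, M.pathLinear n a), ?_⟩, ?_⟩
    · rw [mem_pullbackX]
      simp [pathEval_pathLinear]
    · exact (M.pathEval_pathLinear 1 a).trans (one_smul K a)
  · rintro p q r h h' ⟨⟨l, γ⟩, hγ⟩ hd he
    change (M.pathEval 1).toFun q γ = 0 at he
    have hl : L.d h' l = 0 := congrArg (fun a => a.1.1) hd
    have hdγ : M.path.d h' γ = 0 := congrArg (fun a => a.1.2) hd
    replace hγ : f.toFun q l = (M.pathEval 0).toFun q γ := hγ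
    set π := M.pathPrimitive h γ with hπ
    have h1 : M.path.d h π = γ - M.pathConst q (f.toFun q l) := by
      rw [hπ, M.path_d_pathPrimitive h h' γ hdγ, hγ]
    set β := (M.pathEval 1).toFun p π with hβ
    have h2 : M.d h β = - f.toFun q l := by
      rw [hβ, ← Hom.map_d, h1, map_sub, he, pathEval_pathConst, zero_sub]
    obtain ⟨l', hl'⟩ := hf.exists_primitive h h' l hl (-β) (by rw [map_neg, h2, neg_neg])
    -- The primitives `l'` of `l` and `π` of `γ - γ(0)` need not fit together: shifting `π` to start
    -- at `f l'` makes it end at the cocycle `f l' + β` instead of `0`. This cocycle equals `f l'' +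
    -- d m`; the defect is removed by subtracting `l''` from `l'` and `d(t m)` from the path.
    obtain ⟨l'', m, hl'', hm⟩ := hf.exists_cocycle (sub_add_cancel p 1) h (f.toFun p l' + β)
      (by rw [map_add, ← f.map_d, hl', h2, add_neg_cancel])
    obtain ⟨γ', hγ0, hγd, hγ1⟩ : ∃ γ' : M.path.X p, (M.pathEval 0).toFun p γ' = f.toFun p (l' - l'')
        ∧ M.path.d h γ' = γ ∧ (M.pathEval 1).toFun p γ' = 0 := by
      refine ⟨π + M.pathConst p (f.toFun p (l' - l''))
        - M.path.d (sub_add_cancel p 1) (M.pathLinear (p - 1) m), ?_, ?_, ?_⟩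
      · rw [map_sub ((M.pathEval 0).toFun p), map_add, Hom.map_d, pathEval_pathConst,
          pathEval_pathLinear, hπ, pathEval_zero_pathPrimitive, zero_smul, map_zero, sub_zero,
          zero_add]
      · rw [map_sub (M.path.d h), map_add, h1, M.path.d_d, path_d_pathConst, ← f.map_d, map_sub,
          hl', hl'', sub_zero, sub_zero, sub_add_cancel]
      · rw [map_sub ((M.pathEval 1).toFun p), map_add, Hom.map_d, pathEval_pathConst,
          pathEval_pathLinear, ← hβ, one_smul, hm, map_sub]
        abel
    refine ⟨⟨(l' - l'', γ'), hγ0.symm⟩, Subtype.ext (Prod.ext ?_ hγd), hγ1⟩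
    change L.d h (l' - l'') = l
    rw [map_sub, hl', hl'', sub_zero]

theorem QuasiIsomorphic.spanEquivalent [CharZero K] {L M : DGLieAlgebra.{u, u} K}
    (h : QuasiIsomorphic L M) : SpanEquivalent L M := by
  induction h with
  | rel _ _ h => exact h.choose_spec.spanEquivalent
  | refl => exact .refl _
  | symm _ _ _ ih => exact ih.symm
  | trans _ _ _ _ _ ih ih' => exact ih.trans ih'

end PathFibration

/-! ### Twisted differentials modulo `ħ³` and their transport along a span. -/

section Deformation

variable {K : Type u} [Field K]

/-- The Jacobi identity with a repeated odd entry. Together with the Maurer-Cartan equation it makes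
the twisted differential square to zero modulo `ħ³`. -/
theorem bracket_bracket_self (L : DGLieAlgebra.{u, v} K) {n m s : ℤ} (h : 1 + n = m) (h' : 1 + m = s)
    (h2 : 2 + n = s) (α : L.X 1) (x : L.X n) :
    L.bracket h2 (L.bracket one_add_one_eq_two α α) x
      = (2 : K) • L.bracket h' α (L.bracket h α x) := by
  have hn : n + 1 = m := by omega
  have hm : m + 1 = s := by omega
  have J := L.jacobi one_add_one_eq_two h hn h2 hm hm α α x
  rw [L.skew hn h, map_neg, LinearMap.neg_apply, L.skew hm h' (L.bracket h α x) α] at J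
  subst h
  simp only [one_mul, mul_one, Int.negOnePow_add, Int.negOnePow_one] at J
  rcases Int.units_eq_one_or n.negOnePow with e | e <;>
  simp only [e, one_smul, Units.neg_smul, mul_one, mul_neg, neg_neg, map_neg,
    LinearMap.neg_apply] at J <;>
  rw [L.skew hm h' (L.bracket _ α x) α] at J <;>
  simp only [e, one_smul, Units.neg_smul, mul_one, mul_neg, neg_neg, Int.negOnePow_add,
    Int.negOnePow_one] at J
  · linear_combination (norm := module) J
  · linear_combination (norm := module) -J

theorem bracket_derivation (L : DGLieAlgebra.{u, v} K) (α : L.X 1) (x y : L.X 0) :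
    L.bracket (add_zero 1) α (L.bracket (add_zero 0) x y)
      = L.bracket (add_zero 1) (L.bracket (add_zero 1) α x) y
        + L.bracket (zero_add 1) x (L.bracket (add_zero 1) α y) := by
  have J := L.jacobi (add_zero 1) (add_zero 0) (zero_add 1) (add_zero 1) (zero_add 1)
    (add_zero 1) α x y
  rw [L.skew (zero_add 1) (add_zero 1) (L.bracket _ x y) α,
    L.skew (add_zero 1) (zero_add 1) (L.bracket _ y α) x,
    L.skew (zero_add 1) (add_zero 1) y α] at J
  simp only [zero_mul, mul_zero, Int.negOnePow_zero, one_smul, map_neg, neg_neg] at J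
  linear_combination (norm := module) -J

/-- The differential `d + [ħ α + ħ² β, ·]` modulo `ħ³`, on elements of degree `0`. -/
def twistedD (L : DGLieAlgebra.{u, v} K) (α β : L.X 1) :
    L.X 0 × L.X 0 × L.X 0 →ₗ[K] L.X 1 × L.X 1 × L.X 1 :=
  let d := L.d (zero_add 1)
  let a := L.bracket (add_zero 1) α
  let b := L.bracket (add_zero 1) β
  let p0 := LinearMap.fst K (L.X 0) (L.X 0 × L.X 0)
  let p1 := LinearMap.fst K (L.X 0) (L.X 0) ∘ₗ LinearMap.snd K (L.X 0) (L.X 0 × L.X 0)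
  let p2 := LinearMap.snd K (L.X 0) (L.X 0) ∘ₗ LinearMap.snd K (L.X 0) (L.X 0 × L.X 0)
  (d ∘ₗ p0).prod ((d ∘ₗ p1 + a ∘ₗ p0).prod (d ∘ₗ p2 + a ∘ₗ p1 + b ∘ₗ p0))

/-- Elements of degree `0` modulo `ħ³` closed for `d + [ħ α + ħ² β, ·]`. -/
def twistedCocycles (L : DGLieAlgebra.{u, v} K) (α β : L.X 1) :
    Submodule K (L.X 0 × L.X 0 × L.X 0) := LinearMap.ker (L.twistedD α β)

theorem mem_twistedCocycles (L : DGLieAlgebra.{u, v} K) (α β : L.X 1) (x : L.X 0 × L.X 0 × L.X 0) :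
    x ∈ L.twistedCocycles α β ↔ L.d (zero_add 1) x.1 = 0
      ∧ L.d (zero_add 1) x.2.1 + L.bracket (add_zero 1) α x.1 = 0
      ∧ L.d (zero_add 1) x.2.2 + L.bracket (add_zero 1) α x.2.1
        + L.bracket (add_zero 1) β x.1 = 0 := by
  rw [twistedCocycles, LinearMap.mem_ker, Prod.ext_iff, Prod.ext_iff]
  rfl

/-- The bracket modulo `ħ³`, on elements of degree `0`. -/
def tripleBracket (L : DGLieAlgebra.{u, v} K) (x y : L.X 0 × L.X 0 × L.X 0) :
    L.X 0 × L.X 0 × L.X 0 :=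
  (L.bracket (add_zero 0) x.1 y.1,
    L.bracket (add_zero 0) x.1 y.2.1 + L.bracket (add_zero 0) x.2.1 y.1,
    L.bracket (add_zero 0) x.1 y.2.2 + L.bracket (add_zero 0) x.2.1 y.2.1
      + L.bracket (add_zero 0) x.2.2 y.1)

theorem leibniz_zero (L : DGLieAlgebra.{u, v} K) (x y : L.X 0) :
    L.d (zero_add 1) (L.bracket (add_zero 0) x y)
      = L.bracket (add_zero 1) (L.d (zero_add 1) x) y
        + L.bracket (zero_add 1) x (L.d (zero_add 1) y) := by
  rw [L.leibniz (zero_add 1) (zero_add 1) (zero_add 1) (add_zero 0) (add_zero 1) (zero_add 1)]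
  simp

/-- Each `ħ`-coefficient of the twisted differential is a derivation of the bracket, and the kernel
of a derivation is closed under brackets. -/
theorem tripleBracket_mem (L : DGLieAlgebra.{u, v} K) (α β : L.X 1)
    {x y : L.X 0 × L.X 0 × L.X 0} (hx : x ∈ L.twistedCocycles α β)
    (hy : y ∈ L.twistedCocycles α β) : L.tripleBracket x y ∈ L.twistedCocycles α β := by
  rw [mem_twistedCocycles] at *
  obtain ⟨x0, x1, x2⟩ := hx
  obtain ⟨y0, y1, y2⟩ := hy
  rw [add_assoc] at x2 y2
  simp only [tripleBracket, map_add, leibniz_zero, bracket_derivation, x0, y0,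
    eq_neg_of_add_eq_zero_left x1, eq_neg_of_add_eq_zero_left y1, eq_neg_of_add_eq_zero_left x2,
    eq_neg_of_add_eq_zero_left y2, map_zero, LinearMap.zero_apply, map_neg, LinearMap.neg_apply,
    LinearMap.add_apply]
  refine ⟨by abel, by abel, by abel⟩

/-- A morphism, applied componentwise. -/
def Hom.triple {L M : DGLieAlgebra.{u, v} K} (f : Hom L M) :
    L.X 0 × L.X 0 × L.X 0 →ₗ[K] M.X 0 × M.X 0 × M.X 0 :=
  (f.toFun 0).prodMap ((f.toFun 0).prodMap (f.toFun 0))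

theorem Hom.triple_apply {L M : DGLieAlgebra.{u, v} K} (f : Hom L M) (x : L.X 0 × L.X 0 × L.X 0) :
    f.triple x = (f.toFun 0 x.1, f.toFun 0 x.2.1, f.toFun 0 x.2.2) := rfl

theorem Hom.triple_mem {L M : DGLieAlgebra.{u, v} K} (f : Hom L M) {α β : L.X 1}
    {x : L.X 0 × L.X 0 × L.X 0} (hx : x ∈ L.twistedCocycles α β) :
    f.triple x ∈ M.twistedCocycles (f.toFun 1 α) (f.toFun 1 β) := by
  rw [mem_twistedCocycles] at *
  simp only [triple_apply, ← f.map_d, ← f.map_bracket, ← map_add, hx, map_zero, and_self]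

theorem Hom.triple_tripleBracket {L M : DGLieAlgebra.{u, v} K} (f : Hom L M)
    (x y : L.X 0 × L.X 0 × L.X 0) :
    f.triple (L.tripleBracket x y) = M.tripleBracket (f.triple x) (f.triple y) := by
  simp only [triple_apply, tripleBracket, map_add, f.map_bracket]

variable {N C H : DGLieAlgebra.{u, v} K}

/-- For a trivial fibration onto a DG Lie algebra with zero differential, elements with prescribed
differential can be chosen in the kernel. -/
theorem Hom.IsTrivialFibration.exists_sub_cocycle {q : Hom N H} (hq : q.IsTrivialFibration)
    (hH : ∀ {m n : ℤ} (h : m + 1 = n), H.d h = 0) {m n : ℤ} (h : m + 1 = n) (x : N.X m) :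
    ∃ y, N.d h y = N.d h x ∧ q.toFun m y = 0 := by
  -- Every element of `H` is closed, so `q x` lifts to a cocycle, which can be subtracted without
  -- changing the differential.
  obtain ⟨c, hc, hc'⟩ := hq.exists_cocycle h (q.toFun m x) (by rw [hH]; rfl)
  exact ⟨x - c, by rw [map_sub, hc, sub_zero], by rw [map_sub, hc', sub_self]⟩

/-- The triple is the twisted boundary of some `(b0, b1, b2)` in degree `-1`, constructed order by
order inside the kernel of `q`. Its image under `p` is then the boundary of a triple in `C.X (-1)`,
which is zero. -/
theorem triple_eq_zero [CharZero K] {p : Hom N C} {q : Hom N H} (hp : p.IsTrivialFibration)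
    (hq : q.IsTrivialFibration) (hH : ∀ {m n : ℤ} (h : m + 1 = n), H.d h = 0) {α β : N.X 1}
    (hα : N.d (one_add_one_eq_two : (1 : ℤ) + 1 = 2) α = 0)
    (hβ : (2 : K) • N.d (one_add_one_eq_two : (1 : ℤ) + 1 = 2) β
      + N.bracket one_add_one_eq_two α α = 0)
    (hC : Subsingleton (C.X (-1))) {x : N.X 0 × N.X 0 × N.X 0}
    (hx : x ∈ N.twistedCocycles α β) (hq1 : q.toFun 0 x.2.1 = 0) (hq2 : q.toFun 0 x.2.2 = 0)
    (hp0 : p.toFun 0 x.1 = 0) : p.toFun 0 x.2.1 = 0 ∧ p.toFun 0 x.2.2 = 0 := by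
  obtain ⟨R0, R1, R2⟩ := x
  rw [mem_twistedCocycles] at hx
  obtain ⟨h0, h1, h2⟩ := hx
  dsimp only at h0 h1 h2 hq1 hq2 hp0 ⊢
  have e : (-1 : ℤ) + 1 = 0 := by norm_num
  have e' : (1 : ℤ) + -1 = 0 := by norm_num
  have e'' : (2 : ℤ) + -1 = 1 := by norm_num
  have lz : ∀ (a : N.X 1) (b : N.X (-1)), N.d (zero_add 1) (N.bracket e' a b)
      = N.bracket e'' (N.d one_add_one_eq_two a) b - N.bracket (add_zero 1) a (N.d e b) := by
    intro a b
    rw [N.leibniz (one_add_one_eq_two) e (zero_add 1) e' e'' (add_zero 1)]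
    simp [sub_eq_add_neg]
  obtain ⟨b, hb, -⟩ := hp.exists_primitive e (zero_add 1) R0 h0 hp0
  -- Moving the primitive into the kernel of `q` puts the remainder at the next order in that
  -- kernel, where it is exact.
  obtain ⟨b0, hb0, hqb0⟩ := hq.exists_sub_cocycle hH e b
  rw [hb] at hb0
  obtain ⟨b1, hb1, hqb1⟩ := hq.exists_primitive e (zero_add 1) (R1 - N.bracket e' α b0)
    (by rw [map_sub, lz, hα, hb0, eq_neg_of_add_eq_zero_left h1]; simp)
    (by rw [map_sub, hq1, q.map_bracket, hqb0, map_zero, sub_zero])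
  -- The Maurer-Cartan equation gives `[dβ, b0] = -[α, [α, b0]]`, which makes the remainder at order
  -- `ħ²` closed.
  have hJ := N.bracket_bracket_self e' (add_zero 1) e'' α b0
  have hβ' : N.bracket e'' ((2 : K) • N.d one_add_one_eq_two β
      + N.bracket one_add_one_eq_two α α) b0 = 0 := by
    rw [hβ, map_zero, LinearMap.zero_apply]
  rw [map_add, LinearMap.add_apply, hJ, map_smul, LinearMap.smul_apply, ← smul_add,
    smul_eq_zero_iff_right two_ne_zero] at hβ'
  obtain ⟨b2, hb2, hqb2⟩ := hq.exists_primitive e (zero_add 1)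
    (R2 - N.bracket e' α b1 - N.bracket e' β b0)
    (by
      rw [add_assoc] at h2
      rw [map_sub, map_sub, lz, lz, hα, hb0, hb1, eq_neg_of_add_eq_zero_left h2, map_sub,
        eq_neg_of_add_eq_zero_left hβ']
      simp only [map_zero, LinearMap.zero_apply]
      abel)
    (by rw [map_sub, map_sub, hq2, q.map_bracket, q.map_bracket, hqb0, hqb1]; simp)
  have z : ∀ b : N.X (-1), p.toFun (-1) b = 0 := fun b => Subsingleton.elim _ _
  constructor
  · rw [← sub_add_cancel R1 (N.bracket e' α b0), ← hb1, map_add, p.map_d, p.map_bracket, z, z]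
    simp
  · have : R2 = N.d e b2 + N.bracket e' α b1 + N.bracket e' β b0 := by rw [hb2]; abel
    rw [this, map_add, map_add, p.map_d, p.map_bracket, p.map_bracket, z, z, z]
    simp

/-- The two halves of the span remove one obstruction each. At order `ħ`, the obstruction `[α, V0]`
is exact because `p` kills it. Its primitive is moved into the kernel of `q`; since `q β = 0` as
well, the obstruction at order `ħ²` is killed by `q`, hence exact. -/
theorem exists_triple [CharZero K] {p : Hom N C} {q : Hom N H} (hp : p.IsTrivialFibration)
    (hq : q.IsTrivialFibration) (hH : ∀ {m n : ℤ} (h : m + 1 = n), H.d h = 0) {α β : N.X 1}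
    (hα : N.d (one_add_one_eq_two : (1 : ℤ) + 1 = 2) α = 0)
    (hβ : (2 : K) • N.d (one_add_one_eq_two : (1 : ℤ) + 1 = 2) β
      + N.bracket one_add_one_eq_two α α = 0)
    (hqβ : q.toFun 1 β = 0) (v : C.X 0) (hv : C.d (zero_add 1) v = 0)
    (hv' : C.bracket (add_zero 1) (p.toFun 1 α) v = 0) :
    ∃ x ∈ N.twistedCocycles α β, q.toFun 0 x.2.1 = 0 ∧ q.toFun 0 x.2.2 = 0
      ∧ p.toFun 0 x.1 = v := by
  have lz : ∀ (a : N.X 1) (b : N.X 0), N.d one_add_one_eq_two (N.bracket (add_zero 1) a b)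
      = N.bracket (add_zero 2) (N.d one_add_one_eq_two a) b
        - N.bracket (one_add_one_eq_two : (1 : ℤ) + 1 = 2) a (N.d (zero_add 1) b) := by
    intro a b
    rw [N.leibniz (one_add_one_eq_two) (zero_add 1) one_add_one_eq_two (add_zero 1) (add_zero 2)
      one_add_one_eq_two]
    simp [sub_eq_add_neg]
  obtain ⟨V0, h0, hpV0⟩ := hp.exists_cocycle (zero_add 1) v hv
  obtain ⟨W, hW, -⟩ := hp.exists_primitive (zero_add 1) one_add_one_eq_two
    (N.bracket (add_zero 1) α V0) (by rw [lz, hα, h0]; simp) (by rw [p.map_bracket, hpV0, hv'])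
  obtain ⟨V1, h1, hqV1⟩ := hq.exists_sub_cocycle hH (zero_add 1) W
  rw [hW] at h1
  have hJ := N.bracket_bracket_self (add_zero 1) one_add_one_eq_two (add_zero 2) α V0
  have hβ' : N.bracket (add_zero 2) ((2 : K) • N.d one_add_one_eq_two β
      + N.bracket one_add_one_eq_two α α) V0 = 0 := by
    rw [hβ, map_zero, LinearMap.zero_apply]
  rw [map_add, LinearMap.add_apply, hJ, map_smul, LinearMap.smul_apply, ← smul_add,
    smul_eq_zero_iff_right two_ne_zero] at hβ'
  obtain ⟨V2, h2, hqV2⟩ := hq.exists_primitive (zero_add 1) one_add_one_eq_two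
    (N.bracket (add_zero 1) α V1 - N.bracket (add_zero 1) β V0)
    (by
      rw [map_sub, lz, lz, hα, h0, h1, eq_neg_of_add_eq_zero_left hβ']
      simp)
    (by rw [map_sub, q.map_bracket, q.map_bracket, hqV1, hqβ]; simp)
  refine ⟨(V0, -V1, V2), ?_, ?_, hqV2, hpV0⟩
  · rw [mem_twistedCocycles]
    refine ⟨h0, ?_, ?_⟩
    · rw [map_neg, h1, neg_add_cancel]
    · rw [h2, map_neg]; abel
  · rw [map_neg, hqV1, neg_zero]

/-- If `C` is connected to a DG Lie algebra with zero differential by a span of trivial fibrations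
and vanishes in degree `-1`, a class `π` with `[π, π] = 0` in cohomology extends to a Maurer-Cartan
element modulo `ħ³`, such that the closed elements of degree `0` commuting with `π` extend
to a Lie algebra of closed elements for the twisted differential, uniquely so for `0`. -/
theorem SpanEquivalent.exists_deformation [CharZero K] (hs : SpanEquivalent C H)
    (hH : ∀ {m n : ℤ} (h : m + 1 = n), H.d h = 0) (hC : Subsingleton (C.X (-1))) (π B : C.X 1)
    (hπ : C.d one_add_one_eq_two π = 0)
    (hB : (2 : K) • C.d one_add_one_eq_two B + C.bracket one_add_one_eq_two π π = 0) :
    ∃ B' : C.X 1, (2 : K) • C.d one_add_one_eq_two B'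
        + C.bracket one_add_one_eq_two π π = 0 ∧
      ∃ S : Submodule K (C.X 0 × C.X 0 × C.X 0), S ≤ C.twistedCocycles π B' ∧
        (∀ x ∈ S, ∀ y ∈ S, C.tripleBracket x y ∈ S) ∧
        (∀ v, C.d (zero_add 1) v = 0 → C.bracket (add_zero 1) π v = 0 →
          ∃ v1 v2, (v, v1, v2) ∈ S) ∧
        ∀ x ∈ S, x.1 = 0 → x = 0 := by
  obtain ⟨N, p, q, hp, hq⟩ := hs
  obtain ⟨α, hα, rfl⟩ := hp.exists_cocycle one_add_one_eq_two π hπ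
  have e3 : (2 : ℤ) + 1 = 3 := by norm_num
  obtain ⟨β, hβ, -⟩ := hp.exists_primitive_lift one_add_one_eq_two e3
    (-((2 : K)⁻¹ • N.bracket one_add_one_eq_two α α))
    (by
      rw [map_neg, map_smul, N.leibniz one_add_one_eq_two one_add_one_eq_two e3 _ e3
        (by norm_num : (1 : ℤ) + 2 = 3), hα]
      simp) B
    (by
      rw [map_neg, map_smul, p.map_bracket, eq_neg_of_add_eq_zero_right hB, smul_neg, neg_neg,
        inv_smul_smul₀ two_ne_zero])
  -- Normalizing `β` into the kernel of `q` changes `B` by a cocycle, which is why the conclusion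
  -- provides some `B'` instead of `B`.
  obtain ⟨β', hβ', hqβ'⟩ := hq.exists_sub_cocycle hH one_add_one_eq_two β
  have hβ2 : (2 : K) • N.d one_add_one_eq_two β' + N.bracket one_add_one_eq_two α α = 0 := by
    rw [hβ', hβ, smul_neg, smul_inv_smul₀ two_ne_zero, neg_add_cancel]
  -- The twisted cocycles lying over the triples `(v, 0, 0)` of `H`. These triples are closed under
  -- brackets, so `T` is as well.
  let T : Submodule K (N.X 0 × N.X 0 × N.X 0) := N.twistedCocycles α β' ⊓
    LinearMap.ker ((q.toFun 0).prodMap (q.toFun 0) ∘ₗ LinearMap.snd K (N.X 0) (N.X 0 × N.X 0))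
  have hT : ∀ x, x ∈ T ↔ x ∈ N.twistedCocycles α β' ∧ q.toFun 0 x.2.1 = 0
      ∧ q.toFun 0 x.2.2 = 0 := by
    intro x
    rw [Submodule.mem_inf, LinearMap.mem_ker]
    exact and_congr_right fun _ => Prod.ext_iff
  refine ⟨p.toFun 1 β', ?_, T.map p.triple, ?_, ?_, ?_, ?_⟩
  · rw [← p.map_d, ← p.map_bracket, ← map_smul, ← map_add, hβ2, map_zero]
  · rintro _ ⟨x, hx, rfl⟩
    exact p.triple_mem hx.1
  · rintro _ ⟨x, hx, rfl⟩ _ ⟨y, hy, rfl⟩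
    refine ⟨N.tripleBracket x y, (hT _).2 ⟨N.tripleBracket_mem _ _ hx.1 hy.1, ?_⟩,
      p.triple_tripleBracket x y⟩
    obtain ⟨-, x1, x2⟩ := (hT _).1 hx
    obtain ⟨-, y1, y2⟩ := (hT _).1 hy
    simp only [tripleBracket, map_add, q.map_bracket, x1, x2, y1, y2, map_zero,
      LinearMap.zero_apply, add_zero, and_self]
  · intro v hv hv'
    obtain ⟨x, hx, hx1, hx2, rfl⟩ := exists_triple hp hq hH hα hβ2 hqβ' v hv hv'
    exact ⟨_, _, x, (hT _).2 ⟨hx, hx1, hx2⟩, rfl⟩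
  · rintro _ ⟨x, hx, rfl⟩ (h0 : p.toFun 0 x.1 = 0)
    obtain ⟨hx, hx1, hx2⟩ := (hT _).1 hx
    obtain ⟨h1, h2⟩ := triple_eq_zero hp hq hH hα hβ2 hC hx hx1 hx2 h0
    rw [p.triple_apply, h0, h1, h2]
    rfl

end Deformation

end DGLieAlgebra

namespace Hochschild

variable {K : Type u} [Field K]

/-! ### Gerstenhaber brackets in low degree. -/

section Evaluation

variable {A : Type v} [Ring A] [Algebra K A]

theorem ext_zero {f g : Cochain K A 0} (h : ∀ a, f ![a] = g ![a]) : f = g := by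
  refine MultilinearMap.ext fun a => ?_
  rw [show a = ![a 0] by funext j; fin_cases j; rfl]
  exact h _

theorem ext_one {f g : Cochain K A 1} (h : ∀ a b, f ![a, b] = g ![a, b]) : f = g := by
  refine MultilinearMap.ext fun a => ?_
  rw [show a = ![a 0, a 1] by funext j; fin_cases j <;> rfl]
  exact h _ _

theorem ext_two {f g : Cochain K A 2} (h : ∀ a b c, f ![a, b, c] = g ![a, b, c]) : f = g := by
  refine MultilinearMap.ext fun a => ?_
  rw [show a = ![a 0, a 1, a 2] by funext j; fin_cases j <;> rfl]
  exact h _ _ _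

theorem mulCochain_apply (a b : A) : mulCochain K A ![a, b] = a * b := by
  simp [mulCochain, MultilinearMap.mkPiAlgebraFin_apply, List.ofFn_succ]

theorem gerstenhaber_zero_zero_apply (f g : Cochain K A 0) (a : A) :
    gerstenhaber (add_zero 0) f g ![a] = f ![g ![a]] - g ![f ![a]] := by
  have key : ∀ f g : Cochain K A 0, circ (add_zero 0) f g ![a] = f ![g ![a]] := by
    intro f g
    have e0 : ∀ φ : Fin (0 + 1) → Cochain K A 0, ∑ i, φ i = φ 0 := fun φ => Fin.sum_univ_one φ
    have e1 : insertArgs (add_zero 0) 0 g ![a] = ![g ![a]] := by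
      funext j
      fin_cases j
      change g _ = g _
      congr 1
      funext l
      fin_cases l
      rfl
    rw [circ_apply, e0, ← e1]
    simp [insertAt_apply]
  rw [gerstenhaber_apply (add_zero 0) (add_zero 0)]
  simp [key]

theorem gerstenhaber_one_zero_apply (f : Cochain K A 1) (g : Cochain K A 0) (a b : A) :
    gerstenhaber (add_zero 1) f g ![a, b]
      = f ![g ![a], b] + f ![a, g ![b]] - g ![f ![a, b]] := by
  have k1 : circ (add_zero 1) f g ![a, b] = f ![g ![a], b] + f ![a, g ![b]] := by
    have e0 : ∀ φ : Fin (1 + 1) → Cochain K A 1, ∑ i, φ i = φ 0 + φ 1 := Fin.sum_univ_two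
    have e1 : insertArgs (add_zero 1) 0 g ![a, b] = ![g ![a], b] := by
      funext j
      fin_cases j
      · change g _ = g _
        congr 1
        funext l
        fin_cases l
        rfl
      · rfl
    have e2 : insertArgs (add_zero 1) 1 g ![a, b] = ![a, g ![b]] := by
      funext j
      fin_cases j
      · rfl
      · change g _ = g _
        congr 1
        funext l
        fin_cases l
        rfl
    rw [circ_apply, e0, ← e1, ← e2]
    simp [insertAt_apply]
  have k2 : circ (zero_add 1) g f ![a, b] = g ![f ![a, b]] := by
    have e0 : ∀ φ : Fin (0 + 1) → Cochain K A 1, ∑ i, φ i = φ 0 := fun φ => Fin.sum_univ_one φ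
    have e1 : insertArgs (zero_add 1) 0 f ![a, b] = ![f ![a, b]] := by
      funext j
      fin_cases j
      change f _ = f _
      congr 1
      funext l
      fin_cases l <;> rfl
    rw [circ_apply, e0, ← e1]
    simp [insertAt_apply]
  rw [gerstenhaber_apply (add_zero 1) (zero_add 1)]
  simp [k1, k2]

theorem gerstenhaber_one_one_apply (f g : Cochain K A 1) (a b c : A) :
    gerstenhaber one_add_one_eq_two f g ![a, b, c]
      = f ![g ![a, b], c] - f ![a, g ![b, c]] + (g ![f ![a, b], c] - g ![a, f ![b, c]]) := by
  have key : ∀ f g : Cochain K A 1, circ one_add_one_eq_two f g ![a, b, c]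
      = f ![g ![a, b], c] - f ![a, g ![b, c]] := by
    intro f g
    have e0 : ∀ φ : Fin (1 + 1) → Cochain K A 2, ∑ i, φ i = φ 0 + φ 1 := Fin.sum_univ_two
    have e1 : insertArgs one_add_one_eq_two 0 g ![a, b, c] = ![g ![a, b], c] := by
      funext j
      fin_cases j
      · change g _ = g _
        congr 1
        funext l
        fin_cases l <;> rfl
      · rfl
    have e2 : insertArgs one_add_one_eq_two 1 g ![a, b, c] = ![a, g ![b, c]] := by
      funext j
      fin_cases j
      · rfl
      · change g _ = g _
        congr 1
        funext l
        fin_cases l <;> rfl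
    rw [circ_apply, e0, ← e1, ← e2]
    simp [insertAt_apply, sub_eq_add_neg]
  rw [gerstenhaber_apply one_add_one_eq_two one_add_one_eq_two]
  simp [key]

end Evaluation

/-! ### The deformation statement for Hochschild cochains. -/

section Formal

variable {A : Type u} [Ring A] [Algebra K A] [CharZero K]

/-- The truncation supplies the uniqueness clause: degree `-1`, which would contain the elements of
`A` acting by inner derivations, is zero. -/
theorem exists_deformation_of_isFormal (hf : (truncatedDGLie K A).IsFormal) (P B : Cochain K A 1)
    (hP : gerstenhaber one_add_one_eq_two (mulCochain K A) P = 0)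
    (hB : (2 : K) • gerstenhaber one_add_one_eq_two (mulCochain K A) B
      + gerstenhaber one_add_one_eq_two P P = 0) :
    ∃ B' : Cochain K A 1, (2 : K) • gerstenhaber one_add_one_eq_two (mulCochain K A) B'
      + gerstenhaber one_add_one_eq_two P P = 0 ∧
      ∃ S : Submodule K (Cochain K A 0 × Cochain K A 0 × Cochain K A 0),
        (∀ x ∈ S, gerstenhaber (add_zero 1) (mulCochain K A) x.1 = 0 ∧
          gerstenhaber (add_zero 1) (mulCochain K A) x.2.1
            + gerstenhaber (add_zero 1) P x.1 = 0 ∧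
          gerstenhaber (add_zero 1) (mulCochain K A) x.2.2
            + gerstenhaber (add_zero 1) P x.2.1
            + gerstenhaber (add_zero 1) B' x.1 = 0) ∧
        (∀ x ∈ S, ∀ y ∈ S, (gerstenhaber (add_zero 0) x.1 y.1,
          gerstenhaber (add_zero 0) x.1 y.2.1 + gerstenhaber (add_zero 0) x.2.1 y.1,
          gerstenhaber (add_zero 0) x.1 y.2.2 + gerstenhaber (add_zero 0) x.2.1 y.2.1
            + gerstenhaber (add_zero 0) x.2.2 y.1) ∈ S) ∧
        (∀ v, gerstenhaber (add_zero 1) (mulCochain K A) v = 0 →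
          gerstenhaber (add_zero 1) P v = 0 → ∃ v1 v2, (v, v1, v2) ∈ S) ∧
        ∀ x ∈ S, x.1 = 0 → x = 0 := by
  have d0 : ∀ a : Cochain K A 0, (truncatedDGLie K A).d (zero_add 1) a
      = gerstenhaber (add_zero 1) (mulCochain K A) a :=
    fun a => truncatedD_ofNat (p := 0) (q := 1) (zero_add 1) rfl a
  have d1 : ∀ a : Cochain K A 1, (truncatedDGLie K A).d one_add_one_eq_two a
      = gerstenhaber one_add_one_eq_two (mulCochain K A) a :=
    fun a => truncatedD_ofNat (p := 1) (q := 2) one_add_one_eq_two rfl a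
  obtain ⟨B', hB', S, hS, hbr, hex, huniq⟩ :=
    (DGLieAlgebra.QuasiIsomorphic.spanEquivalent hf).exists_deformation (fun _ => rfl)
      (inferInstanceAs (Subsingleton PUnit)) P B ((d1 P).trans hP)
      ((congrArg (fun z : Cochain K A 2 => (2 : K) • z + _) (d1 B)).trans hB)
  refine ⟨B', (congrArg (fun z : Cochain K A 2 => (2 : K) • z + _) (d1 B')).symm.trans hB', S, ?_, hbr, ?_, huniq⟩
  · intro x hx
    obtain ⟨h1, h2, h3⟩ := (DGLieAlgebra.mem_twistedCocycles _ _ _ _).1 (hS hx)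
    exact ⟨(d0 x.1).symm.trans h1, (congrArg (fun z : Cochain K A 1 => z + _) (d0 x.2.1)).symm.trans h2,
      (congrArg (fun z : Cochain K A 1 => z + _ + _) (d0 x.2.2)).symm.trans h3⟩
  · intro v hv hv'
    exact hex v ((d0 v).trans hv) hv'

end Formal

/-! ### Poisson bracket, Moyal product and Hamiltonian vector fields. -/

section Poisson

variable {K : Type u} [Field K] {A : Type v} [CommRing A] [Algebra K A] (D E : Derivation K A A)

/-- The Poisson bracket `D f E g - E f D g` of two derivations. -/
def poisson (f g : A) : A := D f * E g - E f * D g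

/-- The cochain `(a, b) ↦ φ a * ψ b`. -/
def cup (φ ψ : A →ₗ[K] A) : Cochain K A 1 := (mulCochain K A).compLinearMap ![φ, ψ]

@[simp]
theorem cup_apply (φ ψ : A →ₗ[K] A) (a b : A) : cup φ ψ ![a, b] = φ a * ψ b := by
  rw [cup, MultilinearMap.compLinearMap_apply, ← mulCochain_apply (K := K)]
  congr 1
  funext j
  fin_cases j <;> rfl

/-- The Poisson bracket as a cochain. -/
def poissonCochain : Cochain K A 1 := cup (D : A →ₗ[K] A) E - cup (E : A →ₗ[K] A) D

@[simp]
theorem poissonCochain_apply (a b : A) : poissonCochain D E ![a, b] = poisson D E a b := by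
  simp [poissonCochain, poisson]

/-- The second-order term of the Moyal product. -/
noncomputable def moyalCochain : Cochain K A 1 :=
  (2 : K)⁻¹ • (cup ((D : A →ₗ[K] A) ∘ₗ D) (E ∘ₗ (E : A →ₗ[K] A))
    - (2 : K) • cup ((D : A →ₗ[K] A) ∘ₗ E) (D ∘ₗ (E : A →ₗ[K] A))
    + cup ((E : A →ₗ[K] A) ∘ₗ E) (D ∘ₗ (D : A →ₗ[K] A)))

/-- Linear maps as cochains of degree `0`. -/
def linearCochain (φ : A →ₗ[K] A) : Cochain K A 0 :=
  MultilinearMap.ofSubsingleton K A A (0 : Fin 1) φ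

@[simp]
theorem linearCochain_apply (φ : A →ₗ[K] A) (a : A) : linearCochain φ ![a] = φ a := rfl

/-- The Hamiltonian vector field of `f`. -/
def hamiltonian (f : A) : Derivation K A A := D f • E - E f • D

@[simp]
theorem hamiltonian_apply (f g : A) : hamiltonian D E f g = poisson D E f g := rfl

theorem gerstenhaber_mul_poissonCochain :
    gerstenhaber one_add_one_eq_two (mulCochain K A) (poissonCochain D E) = 0 := by
  refine ext_two fun a b c => ?_
  rw [gerstenhaber_one_one_apply]
  simp only [mulCochain_apply, poissonCochain_apply, poisson, Derivation.leibniz, smul_eq_mul,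
    zero_apply]
  ring

/-- Associativity at order `ħ²` of the Moyal product, multiplication after `exp(ħ(D ⊗ E - E ⊗ D))`,
which holds because `D` and `E` commute. Its role is to show that `[π, π]` is exact. -/
theorem two_gerstenhaber_mul_moyalCochain [CharZero K] (hDE : ∀ a, D (E a) = E (D a)) :
    (2 : K) • gerstenhaber one_add_one_eq_two (mulCochain K A) (moyalCochain D E)
      + gerstenhaber one_add_one_eq_two (poissonCochain D E) (poissonCochain D E) = 0 := by
  rw [moyalCochain, map_smul, smul_inv_smul₀ two_ne_zero]
  refine ext_two fun a b c => ?_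
  rw [add_apply, gerstenhaber_one_one_apply, gerstenhaber_one_one_apply]
  simp only [mulCochain_apply, poissonCochain_apply, poisson, Derivation.leibniz, smul_eq_mul,
    zero_apply, add_apply, sub_apply,
    cup_apply, LinearMap.comp_apply, Derivation.coeFn_coe, map_add,
    map_sub, hDE, two_smul]
  ring

theorem gerstenhaber_mul_derivation (δ : Derivation K A A) :
    gerstenhaber (add_zero 1) (mulCochain K A) (linearCochain (δ : A →ₗ[K] A)) = 0 := by
  refine ext_one fun a b => ?_
  rw [gerstenhaber_one_zero_apply]
  simp only [mulCochain_apply, linearCochain_apply, Derivation.coeFn_coe, Derivation.leibniz,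
    smul_eq_mul, zero_apply]
  ring

theorem poisson_jacobi (hDE : ∀ a, D (E a) = E (D a)) (f a b : A) :
    poisson D E f (poisson D E a b)
      = poisson D E (poisson D E f a) b + poisson D E a (poisson D E f b) := by
  simp only [poisson, map_sub, Derivation.leibniz, smul_eq_mul, hDE]
  ring

/-- A restatement of the Jacobi identity: Hamiltonian vector fields are derivations of the Poisson
bracket. -/
theorem gerstenhaber_poissonCochain_hamiltonian (hDE : ∀ a, D (E a) = E (D a)) (f : A) :
    gerstenhaber (add_zero 1) (poissonCochain D E)
      (linearCochain (hamiltonian D E f : A →ₗ[K] A)) = 0 := by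
  refine ext_one fun a b => ?_
  rw [gerstenhaber_one_zero_apply]
  simp only [poissonCochain_apply, linearCochain_apply, Derivation.coeFn_coe, hamiltonian_apply,
    zero_apply]
  rw [poisson_jacobi D E hDE f a b]
  ring

end Poisson

/-! ### The contradiction, evaluated at the origin. -/

section Polynomial

open MvPolynomial

variable {K : Type u} [Field K] {σ : Type v}

/-- Followed by evaluation at the origin, a derivation is a tangent vector, determined by its values
on the coordinates. -/
theorem constantCoeff_derivation_eq_zero
    (δ : Derivation K (MvPolynomial σ K) (MvPolynomial σ K))
    (h : ∀ k, constantCoeff (δ (X k)) = 0) (g : MvPolynomial σ K) : constantCoeff (δ g) = 0 := by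
  induction g using MvPolynomial.induction_on with
  | C a => rw [← algebraMap_eq, Derivation.map_algebraMap, map_zero]
  | add p q hp hq => rw [map_add, map_add, hp, hq, add_zero]
  | mul_X p k _ => simp [Derivation.leibniz, h]

/-- Closed elements of degree `0` for a star product `1 + ħ {·,·} + ħ² B` modulo `ħ³` which extend
Hamiltonian vector fields cannot satisfy the Lie algebra relations of the latter. -/
theorem no_hamiltonian_deformation [CharZero K] {i j : σ} (hij : i ≠ j)
    (B : MvPolynomial σ K →ₗ[K] MvPolynomial σ K →ₗ[K] MvPolynomial σ K)
    (e v1 v2 v3 v4 : Derivation K (MvPolynomial σ K) (MvPolynomial σ K))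
    (w1 w2 w3 w4 : MvPolynomial σ K →ₗ[K] MvPolynomial σ K)
    {pb : MvPolynomial σ K → MvPolynomial σ K → MvPolynomial σ K}
    (hpb : pb = poisson (pderiv i) (pderiv j))
    (hB : ∀ a b c, B a b * c - a * B b c + (B (a * b) c - B a (b * c))
      + (pb (pb a b) c - pb a (pb b c)) = 0)
    (hw1 : ∀ a b, w1 a * b + a * w1 b - w1 (a * b)
      + (pb (v1 a) b + pb a (v1 b) - v1 (pb a b))
      + (B (pb (X i ^ 3) a) b + B a (pb (X i ^ 3) b) - pb (X i ^ 3) (B a b)) = 0)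
    (hw3 : ∀ a b, w3 a * b + a * w3 b - w3 (a * b)
      + (pb (v3 a) b + pb a (v3 b) - v3 (pb a b))
      + (B (pb (X i ^ 2) a) b + B a (pb (X i ^ 2) b) - pb (X i ^ 2) (B a b)) = 0)
    (h1 : ∀ a, pb (X i * X j) (v1 a) - v1 (pb (X i * X j) a)
      + (e (pb (X i ^ 3) a) - pb (X i ^ 3) (e a)) = -3 * v1 a)
    (h2 : ∀ a, pb (X i * X j) (v2 a) - v2 (pb (X i * X j) a)
      + (e (pb (X j ^ 4) a) - pb (X j ^ 4) (e a)) = 4 * v2 a)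
    (h3 : ∀ a, pb (X i * X j) (v3 a) - v3 (pb (X i * X j) a)
      + (e (pb (X i ^ 2) a) - pb (X i ^ 2) (e a)) = -2 * v3 a)
    (h4 : ∀ a, pb (X i * X j) (v4 a) - v4 (pb (X i * X j) a)
      + (e (pb (X i * X j ^ 4) a) - pb (X i * X j ^ 4) (e a)) = 3 * v4 a)
    (hmain : ∀ a, 2 * (pb (X i ^ 3) (w2 a) - w2 (pb (X i ^ 3) a) + (v1 (v2 a) - v2 (v1 a))
        + (w1 (pb (X j ^ 4) a) - pb (X j ^ 4) (w1 a)))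
      = 3 * (pb (X i ^ 2) (w4 a) - w4 (pb (X i ^ 2) a) + (v3 (v4 a) - v4 (v3 a))
        + (w3 (pb (X i * X j ^ 4) a) - pb (X i * X j ^ 4) (w3 a)))) : False := by
  subst hpb
  set D := pderiv (R := K) i
  set E := pderiv (R := K) j
  set x : MvPolynomial σ K := X i
  set y : MvPolynomial σ K := X j
  have Dx : D x = 1 := pderiv_X_self i
  have Dy : D y = 0 := pderiv_X_of_ne hij.symm
  have Ex : E x = 0 := pderiv_X_of_ne hij
  have Ey : E y = 1 := pderiv_X_self j
  have Dz : ∀ k, k ≠ i → D (X k) = 0 := fun k hk => pderiv_X_of_ne hk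
  have Ez : ∀ k, k ≠ j → E (X k) = 0 := fun k hk => pderiv_X_of_ne hk
  have εx : constantCoeff x = 0 := constantCoeff_X K i
  have εy : constantCoeff y = 0 := constantCoeff_X K j
  have gen : ∀ (δ : Derivation K (MvPolynomial σ K) (MvPolynomial σ K)),
      constantCoeff (δ x) = 0 → constantCoeff (δ y) = 0 →
      (∀ k, k ≠ i → k ≠ j → constantCoeff (δ (X k)) = 0) → ∀ g, constantCoeff (δ g) = 0 := by
    intro δ hx hy hz
    refine constantCoeff_derivation_eq_zero δ fun k => ?_
    rcases eq_or_ne k i with rfl | hk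
    · exact hx
    rcases eq_or_ne k j with rfl | hk'
    · exact hy
    exact hz k hk hk'
  have ε2 : constantCoeff (2 : MvPolynomial σ K) = 2 := map_ofNat _ 2
  have ε3 : constantCoeff (3 : MvPolynomial σ K) = 3 := map_ofNat _ 3
  have ε4 : constantCoeff (4 : MvPolynomial σ K) = 4 := map_ofNat _ 4
  -- A weight argument. Evaluated at the origin, the left side of `h1` becomes `v1 x` on `x`, `-v1
  -- y` on `y` and `0` on the other variables: the `e`-terms vanish because `x³` has order at least
  -- three. None of the factors `1`, `-1`, `0` equals `-3`. The same works for `v2` and `v4`, with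
  -- eigenvalues `4` and `3`.
  have z1 : ∀ g, constantCoeff (v1 g) = 0 := by
    refine gen v1 ?_ ?_ ?_
    · have := congrArg constantCoeff (h1 x)
      simp [poisson, Derivation.leibniz, Derivation.leibniz_pow, Dx, Dy, Ex, Ey, εx, εy, ε3] at this
      linear_combination (1 / 4 : K) * this
    · have := congrArg constantCoeff (h1 y)
      simp [poisson, Derivation.leibniz, Derivation.leibniz_pow, Dx, Dy, Ex, Ey, εx, εy, ε2, ε3] at this
      linear_combination (-1 / 2 : K) * this
    · intro k hk hk'
      have := congrArg constantCoeff (h1 (X k))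
      simpa [poisson, Derivation.leibniz, Derivation.leibniz_pow, Dx, Dy, Ex, Ey, εx, εy, ε2, ε3, ε4,
        Dz k hk, Ez k hk'] using this
  have z2 : ∀ g, constantCoeff (v2 g) = 0 := by
    refine gen v2 ?_ ?_ ?_
    · have := congrArg constantCoeff (h2 x)
      simp [poisson, Derivation.leibniz, Derivation.leibniz_pow, Dx, Dy, Ex, Ey, εx, εy, ε3, ε4] at this
      linear_combination (-1 / 3 : K) * this
    · have := congrArg constantCoeff (h2 y)
      simp [poisson, Derivation.leibniz, Derivation.leibniz_pow, Dx, Dy, Ex, Ey, εx, εy, ε4] at this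
      linear_combination (-1 / 5 : K) * this
    · intro k hk hk'
      have := congrArg constantCoeff (h2 (X k))
      simpa [poisson, Derivation.leibniz, Derivation.leibniz_pow, Dx, Dy, Ex, Ey, εx, εy, ε2, ε3, ε4,
        Dz k hk, Ez k hk'] using this
  have z4 : ∀ g, constantCoeff (v4 g) = 0 := by
    refine gen v4 ?_ ?_ ?_
    · have := congrArg constantCoeff (h4 x)
      simp [poisson, Derivation.leibniz, Derivation.leibniz_pow, Dx, Dy, Ex, Ey, εx, εy, ε3, ε4] at this
      linear_combination (-1 / 2 : K) * this
    · have := congrArg constantCoeff (h4 y)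
      simp [poisson, Derivation.leibniz, Derivation.leibniz_pow, Dx, Dy, Ex, Ey, εx, εy, ε3, ε4] at this
      linear_combination (-1 / 4 : K) * this
    · intro k hk hk'
      have := congrArg constantCoeff (h4 (X k))
      simpa [poisson, Derivation.leibniz, Derivation.leibniz_pow, Dx, Dy, Ex, Ey, εx, εy, ε2, ε3, ε4,
        Dz k hk, Ez k hk'] using this
  -- For the quadratic function `x²` the term `e(2x)` survives on `y`, so `v3 y` at the origin stays
  -- undetermined; only the other coordinates are controlled.
  have z3x : constantCoeff (v3 x) = 0 := by
    have := congrArg constantCoeff (h3 x)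
    simp [poisson, Derivation.leibniz, Derivation.leibniz_pow, Dx, Dy, Ex, Ey, εx, εy, ε2] at this
    linear_combination (1 / 3 : K) * this
  have z3z : ∀ k, k ≠ i → k ≠ j → constantCoeff (v3 (X k)) = 0 := by
    intro k hk hk'
    have := congrArg constantCoeff (h3 (X k))
    simpa [poisson, Derivation.leibniz, Derivation.leibniz_pow, Dx, Dy, Ex, Ey, εx, εy, ε2,
      Dz k hk, Ez k hk'] using this
  -- This derivative is the coefficient of the undetermined `v3 y` in `v3 (v4 x)` at the origin. It
  -- satisfies `2u = 3u`.
  have z4x : constantCoeff (E (v4 x)) = 0 := by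
    have := congrArg (fun g => constantCoeff (E g)) (h4 x)
    simp [poisson, Derivation.leibniz, Derivation.leibniz_pow, Dx, Dy, Ex, Ey, εx, εy, ε3, z4] at this
    linear_combination -this
  have z3 : constantCoeff (v3 (v4 x)) = 0 := by
    have := gen (v3 - v3 y • E)
      (by simp [Ex, z3x]) (by simp [Ey]) (fun k hk hk' => by simp [Ez k hk', z3z k hk hk']) (v4 x)
    simpa [z4x] using this
  -- At the origin, `m` reads `2 w1(y³) = 3 w3(xy³)`. By `c1` and `c3`, `w1(y³) = 3B(x², y²) + 6B(y,
  -- x²y)` and `w3(xy³) = 6B(x, xy²)`. Associativity gives `B(x², y²) - B(x, xy²) = 2` from `b1`.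
  -- From `b2` and `b3`, both `B(xy, xy) - B(y, x²y)` and `B(xy, xy) - B(x, xy²)` equal `-1`.
  have b1 := congrArg constantCoeff (hB x x (y * y))
  have b2 := congrArg constantCoeff (hB y x (x * y))
  have b3 := congrArg constantCoeff (hB x y (x * y))
  have c1 := congrArg constantCoeff (hw1 y (y * y))
  have c3 := congrArg constantCoeff (hw3 x (y * y * y))
  have m := congrArg constantCoeff (hmain x)
  simp [poisson, Derivation.leibniz, Derivation.leibniz_pow, Dx, Dy, Ex, Ey, εx, εy, ε2, ε3, z1, z2,
    z3, z4] at b1 b2 b3 c1 c3 m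
  rw [mul_comm y x, show x * (x * y) = x * x * y by ring] at b2
  rw [show y * (x * y) = x * (y * y) by ring] at b3
  rw [show 3 * x ^ 2 = 3 • (x * x) by rw [nsmul_eq_mul]; push_cast; ring,
    show 3 • (x * x) * (y + y) = 6 • (x * x * y) by simp only [nsmul_eq_mul]; push_cast; ring,
    show y * (y * y) = y ^ 3 by ring] at c1
  rw [show 2 * x * (y * y + y * (y + y)) = 6 • (x * (y * y)) by rw [nsmul_eq_mul]; push_cast; ring,
    show x * (y * y * y) = x * y ^ 3 by ring] at c3
  rw [show 4 * y ^ 3 = 4 • y ^ 3 by rw [nsmul_eq_mul]; push_cast; ring,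
    show x * 4 • y ^ 3 = 4 • (x * y ^ 3) by rw [mul_smul_comm]] at m
  simp only [map_nsmul, LinearMap.smul_apply] at c1 c3 m
  simp only [nsmul_eq_mul] at c1 c3 m
  push_cast at c1 c3 m
  -- Elimination leaves `24 (B(x², y²) - B(x, xy²)) = 0`, whereas `b1` makes this difference `2`.
  have : (48 : K) = 0 := by
    linear_combination m + 8 * c1 - 12 * c3 - 24 * b1 + 48 * b2 - 48 * b3
  norm_num at this

end Polynomial

/-! ### Cochains as linear maps, derivations and bilinear maps. -/

section Final

variable {K : Type u} [Field K] {A : Type v} [CommRing A] [Algebra K A]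

theorem exists_linearCochain (f : Cochain K A 0) : ∃ φ : A →ₗ[K] A, f = linearCochain φ := by
  obtain ⟨φ, rfl⟩ := (MultilinearMap.ofSubsingleton K A A (0 : Fin 1)).surjective f
  exact ⟨φ, rfl⟩

/-- The bracket of a linear map with the multiplication is its defect in the Leibniz rule. -/
theorem exists_derivation (f : Cochain K A 0)
    (h : gerstenhaber (add_zero 1) (mulCochain K A) f = 0) :
    ∃ δ : Derivation K A A, f = linearCochain (δ : A →ₗ[K] A) := by
  obtain ⟨φ, rfl⟩ := exists_linearCochain f
  refine ⟨Derivation.mk' φ fun a b => ?_, rfl⟩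
  have := congrArg (fun P : Cochain K A 1 => P ![a, b]) h
  simp only [gerstenhaber_one_zero_apply, mulCochain_apply, linearCochain_apply, zero_apply] at this
  simp only [smul_eq_mul]
  linear_combination -this

theorem exists_bilinear (P : Cochain K A 1) :
    ∃ β : A →ₗ[K] A →ₗ[K] A, ∀ a b, P ![a, b] = β a b := by
  have e1 : ∀ a b : A, Function.update ![0, b] 0 a = ![a, b] := fun a b => by
    funext j; fin_cases j <;> rfl
  have e2 : ∀ a b : A, Function.update ![a, 0] 1 b = ![a, b] := fun a b => by
    funext j; fin_cases j <;> rfl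
  refine ⟨LinearMap.mk₂ K (fun a b => P ![a, b]) ?_ ?_ ?_ ?_, fun a b => rfl⟩
  · intro a a' b
    rw [← e1 (a + a') b, P.map_update_add, e1, e1]
  · intro c a b
    rw [← e1 (c • a) b, P.map_update_smul, e1]
  · intro a b b'
    rw [← e2 a (b + b'), P.map_update_add, e2, e2]
  · intro c a b
    rw [← e2 a (c • b), P.map_update_smul, e2]

theorem gerstenhaber_hamiltonian {D E : Derivation K A A} (hDE : ∀ a, D (E a) = E (D a))
    (f g : A) : gerstenhaber (add_zero 0) (linearCochain (hamiltonian D E f : A →ₗ[K] A))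
      (linearCochain (hamiltonian D E g : A →ₗ[K] A))
      = linearCochain (hamiltonian D E (poisson D E f g) : A →ₗ[K] A) := by
  refine ext_zero fun a => ?_
  rw [gerstenhaber_zero_zero_apply]
  simp only [linearCochain_apply, Derivation.coeFn_coe, hamiltonian_apply]
  rw [poisson_jacobi D E hDE f g a]
  ring

theorem linearCochain_hamiltonian_smul (D E : Derivation K A A) (c : K) (f : A) :
    linearCochain (hamiltonian D E (c • f) : A →ₗ[K] A)
      = c • linearCochain (hamiltonian D E f : A →ₗ[K] A) := by
  refine ext_zero fun a => ?_
  simp [poisson, smul_sub]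

end Final

/-! ### Non-formality for polynomial algebras. -/

section NonFormality

open MvPolynomial

/-- The commutator is a derivation that vanishes on the variables. -/
theorem pderiv_pderiv {K : Type u} [Field K] {σ : Type v} (i j : σ) (a : MvPolynomial σ K) :
    pderiv i (pderiv j a) = pderiv j (pderiv i a) := by
  classical
  have : ⁅pderiv (R := K) i, pderiv (R := K) j⁆ = 0 := by
    refine derivation_ext fun k => ?_
    rw [Derivation.commutator_apply, pderiv_X, pderiv_X]
    rw [Pi.single_apply, Pi.single_apply]
    split_ifs <;> simp
  have := Derivation.congr_fun this a
  rwa [Derivation.commutator_apply, Derivation.zero_apply, sub_eq_zero] at this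

/-- In at least two variables, the truncated Hochschild complex of a polynomial algebra is not
formal. -/
theorem truncatedDGLie_not_isFormal {K : Type u} [Field K] [CharZero K] {d : ℕ}
    {i j : Fin d} (hij : i ≠ j) : ¬ (truncatedDGLie K (MvPolynomial (Fin d) K)).IsFormal := by
  intro hf
  set D := pderiv (R := K) i with hD
  set E := pderiv (R := K) j with hE
  have hDE : ∀ a, D (E a) = E (D a) := fun a => pderiv_pderiv i j a
  obtain ⟨B, hB, S, hS, hbr, hex, huniq⟩ := exists_deformation_of_isFormal hf (poissonCochain D E)
    (moyalCochain D E) (gerstenhaber_mul_poissonCochain D E)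
    (two_gerstenhaber_mul_moyalCochain D E hDE)
  obtain ⟨β, hβ⟩ := exists_bilinear B
  have ex : ∀ f, ∃ (δ : Derivation K (MvPolynomial (Fin d) K) (MvPolynomial (Fin d) K))
      (w : MvPolynomial (Fin d) K →ₗ[K] MvPolynomial (Fin d) K),
      (linearCochain (hamiltonian D E f : MvPolynomial (Fin d) K →ₗ[K] MvPolynomial (Fin d) K),
        linearCochain (δ : MvPolynomial (Fin d) K →ₗ[K] MvPolynomial (Fin d) K), linearCochain w) ∈ S := by
    intro f
    obtain ⟨v1, v2, hv⟩ := hex _ (gerstenhaber_mul_derivation (hamiltonian D E f))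
      (gerstenhaber_poissonCochain_hamiltonian D E hDE f)
    -- Since the Hamiltonian field commutes with `π`, the equation at order `ħ` says that the first
    -- correction is itself closed, hence a derivation.
    have h1 := (hS _ hv).2.1
    rw [gerstenhaber_poissonCochain_hamiltonian D E hDE f, add_zero] at h1
    obtain ⟨δ, rfl⟩ := exists_derivation v1 h1
    obtain ⟨w, rfl⟩ := exists_linearCochain v2
    exact ⟨δ, w, hv⟩
  choose δ w hδ using ex
  -- An element of `S` is determined by its leading term, so a relation among Hamiltonian fields
  -- propagates to the higher coefficients. Order `ħ` is read off here and order `ħ²` in `main`.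
  have rel : ∀ f g h (c : K), poisson D E f g = c • h → ∀ a,
      poisson D E f (δ g a) - δ g (poisson D E f a) + (δ f (poisson D E g a)
        - poisson D E g (δ f a)) = c • δ h a := by
    intro f g h c hfg a
    have h0 := huniq _ (S.sub_mem (hbr _ (hδ f) _ (hδ g)) (S.smul_mem c (hδ h))) (by
      change gerstenhaber _ _ _ - c • _ = 0
      rw [gerstenhaber_hamiltonian hDE, hfg, linearCochain_hamiltonian_smul, sub_self])
    have h1 := congrArg (fun x => x.2.1 ![a]) h0
    simp only [Prod.snd_sub, Prod.fst_sub, Prod.smul_snd, Prod.smul_fst, sub_apply, add_apply,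
      smul_apply, gerstenhaber_zero_zero_apply, linearCochain_apply, Derivation.coeFn_coe,
      hamiltonian_apply, Prod.fst_zero, Prod.snd_zero, zero_apply] at h1
    exact sub_eq_zero.1 h1
  have main : ∀ f g f' g' (c c' : K), c • poisson D E f g = c' • poisson D E f' g' → ∀ a,
      c • (poisson D E f (w g a) - w g (poisson D E f a) + (δ f (δ g a) - δ g (δ f a))
        + (w f (poisson D E g a) - poisson D E g (w f a)))
      = c' • (poisson D E f' (w g' a) - w g' (poisson D E f' a) + (δ f' (δ g' a) - δ g' (δ f' a))
        + (w f' (poisson D E g' a) - poisson D E g' (w f' a))) := by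
    intro f g f' g' c c' hfg a
    have h0 := huniq _ (S.sub_mem (S.smul_mem c (hbr _ (hδ f) _ (hδ g)))
      (S.smul_mem c' (hbr _ (hδ f') _ (hδ g')))) (by
      change c • gerstenhaber _ _ _ - c' • gerstenhaber _ _ _ = 0
      rw [gerstenhaber_hamiltonian hDE, gerstenhaber_hamiltonian hDE,
        ← linearCochain_hamiltonian_smul, ← linearCochain_hamiltonian_smul, hfg, sub_self])
    have h1 := congrArg (fun x => x.2.2 ![a]) h0
    simp only [Prod.snd_sub, Prod.smul_snd, sub_apply, add_apply,
      smul_apply, gerstenhaber_zero_zero_apply, linearCochain_apply, Derivation.coeFn_coe,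
      hamiltonian_apply, Prod.snd_zero, zero_apply] at h1
    exact sub_eq_zero.1 h1
  have assoc : ∀ a b c, β a b * c - a * β b c + (β (a * b) c - β a (b * c))
      + (poisson D E (poisson D E a b) c - poisson D E a (poisson D E b c)) = 0 := by
    intro a b c
    have := congrArg (fun P : Cochain K (MvPolynomial (Fin d) K) 2 => P ![a, b, c]) hB
    simp only [add_apply, smul_apply, gerstenhaber_one_one_apply, mulCochain_apply,
      poissonCochain_apply, hβ, zero_apply, ← two_smul K, ← smul_add] at this
    exact (smul_eq_zero.1 this).resolve_left two_ne_zero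
  have second : ∀ f a b, w f a * b + a * w f b - w f (a * b)
      + (poisson D E (δ f a) b + poisson D E a (δ f b) - δ f (poisson D E a b))
      + (β (poisson D E f a) b + β a (poisson D E f b) - poisson D E f (β a b)) = 0 := by
    intro f a b
    have := congrArg (fun P : Cochain K (MvPolynomial (Fin d) K) 1 => P ![a, b]) (hS _ (hδ f)).2.2
    simpa only [add_apply, gerstenhaber_one_zero_apply, mulCochain_apply, linearCochain_apply,
      poissonCochain_apply, hβ, zero_apply, Derivation.coeFn_coe, hamiltonian_apply] using this
  have Dx : D (X i) = 1 := pderiv_X_self i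
  have Dy : D (X j) = 0 := pderiv_X_of_ne hij.symm
  have Ex : E (X i) = 0 := pderiv_X_of_ne hij
  have Ey : E (X j) = 1 := pderiv_X_self j
  have num : ∀ (n : ℕ) (p : MvPolynomial (Fin d) K), (n : K) • p = n * p := fun n p => by
    rw [Algebra.smul_def, map_natCast]
  have n2 : ∀ p : MvPolynomial (Fin d) K, (2 : K) • p = 2 * p := num 2
  have n3 : ∀ p : MvPolynomial (Fin d) K, (3 : K) • p = 3 * p := num 3
  have n4 : ∀ p : MvPolynomial (Fin d) K, (4 : K) • p = 4 * p := num 4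
  -- Both sides equal `24 x² y³`, with `x = X i` and `y = X j`.
  have hm := main (X i ^ 3) (X j ^ 4) (X i ^ 2) (X i * X j ^ 4) 2 3 (by
    simp [n2, n3, poisson, Derivation.leibniz, Derivation.leibniz_pow, Dx, Dy, Ex, Ey]
    ring)
  -- Bracketing with `xy` multiplies `x^a y^b` by `b - a`, which gives the constants `-3`, `4`,
  -- `-2`, `3`.
  have r1 := rel (X i * X j) (X i ^ 3) (X i ^ 3) (-3) (by
    simp [n3, poisson, Derivation.leibniz, Derivation.leibniz_pow, Dx, Dy, Ex, Ey]
    ring)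
  have r2 := rel (X i * X j) (X j ^ 4) (X j ^ 4) 4 (by
    simp [n4, poisson, Derivation.leibniz, Derivation.leibniz_pow, Dx, Dy, Ex, Ey]
    ring)
  have r3 := rel (X i * X j) (X i ^ 2) (X i ^ 2) (-2) (by
    simp [n2, poisson, Derivation.leibniz, Derivation.leibniz_pow, Dx, Dy, Ex, Ey]
    ring)
  have r4 := rel (X i * X j) (X i * X j ^ 4) (X i * X j ^ 4) 3 (by
    simp [n3, poisson, Derivation.leibniz, Derivation.leibniz_pow, Dx, Dy, Ex, Ey]
    ring)
  simp only [neg_smul, n2, n3, n4, ← neg_mul] at hm r1 r2 r3 r4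
  exact no_hamiltonian_deformation hij β _ _ _ _ _ _ _ _ _ rfl assoc (second _) (second _)
    r1 r2 r3 r4 hm

end NonFormality

end Hochschild

theorem theorem5p1 {K : Type u} [Field K] [CharZero K] (d : ℕ) (hd : Even d) (hpos : 0 < d) :
    ¬ (Hochschild.truncatedDGLie K (MvPolynomial (Fin d) K)).IsFormal := by
  have h : 1 < d := by
    obtain ⟨k, rfl⟩ := hd
    omega
  exact Hochschild.truncatedDGLie_not_isFormal (i := ⟨0, hpos⟩) (j := ⟨1, h⟩)
    (by simp [Fin.ext_iff])
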